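/- Let $(M,J)$ be an almost complex manifold: $M$ is a smooth finite-dimensional manifold (without boundary, Hausdorff, $\sigma$-compact) and $J$ is a smooth field of endomorphisms of $TM$ with $J^2=-\mathbf 1$. Let $$N_J(X,Y)=[JX,JY]-J[JX,Y]-J[X,JY]-[X,Y]$$ be its Nijenhuis tensor. A smooth linear connection $\nabla$ on $TM$ is called *minimal* if $\nabla J=0$ and its torsion is $T_\nabla=\tfrac14N_J$, where $T_\nabla(X,Y)=\nabla_XY-\nabla_YX-[X,Y]$. Let $\pi:TM\to M$ be the projection and $\rho:M\to TM$ the zero section. For $a\in T_xM$ let $V_a=\ker (d\pi)_a\subset T_a(TM)$ be the vertical space, and let $\mathrm{vl}_a:T_xM\to T_a(TM)$, $\mathrm{vl}_a(v)=\frac{d}{dt}\big|_{t=0}(a+tv)$, be the vertical lift. For a linear connection $\nabla$ on $TM$ let $H_a^\nabla\subset T_a(TM)$ be its horizontal space, spanned by the vectors $dY_x(u)-\mathrm{vl}_a(\nabla_uY)$, where $u\in T_xM$ and $Y$ is a vector field with $Y(x)=a$. Then: 1. Minimal connections exist on $(M,J)$. For every minimal connection $\nabla$ and every $a\in TM$,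 $x=\pi(a)$, one has $T_a(TM)=H^\nabla_a\oplus V_a$, and the maps $d\pi:H^\nabla_a\to T_xM$ and $\mathrm{vl}_a:T_xM\to V_a$ are bijective. 2. There is a smooth almost complex structure $\hat J$ on the manifold $TM$ which, for every minimal connection $\nabla$, is the structure $J\oplus J$ with respect to the splitting $T_a(TM)=H^\nabla_a\oplus V_a$ and the isomorphisms $H^\nabla_a\simeq T_xM$, $V_a\simeq T_xM$ above. That is, for every minimal $\nabla$, $\hat J$ is the unique field of endomorphisms of the tangent spaces of $TM$ that preserves each $H_a^\nabla$, satisfies $d\pi(\hat J w)=J\,d\pi(w)$ for $w\in H^\nabla_a$, and satisfies $\hat J\,\mathrm{vl}_a(v)=\mathrm{vl}_a(Jv)$ for $v\in T_xM$. In particular $\hat J$ does not depend on the choice of $\nabla$. 3. The maps $\pi:(TM,\hat J)\to(M,J)$ and $\rho:(M,J)\to(TM,\hat J)$ are pseudoholomorphic, i.e. they are smooth and their differentials intertwine the almost complex structures. 4. $\hat J$ is integrable if and only if $J$ is integrable. Here an almost complex structure is integrable if around every point there are smooth coordinates with values in some $\mathbb C^n$ whose differential intertwines the structure with multiplication by $i$.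 -/

import Mathlib

open Set Bundle VectorField
open scoped Manifold ContDiff

noncomputable section

namespace AlmostComplex

section General

variable {E : Type*} [NormedAddCommGroup E] [NormedSpace ℝ E]
  {H : Type*} [TopologicalSpace H]

/-- A smooth almost complex structure on a smooth manifold `M`: a smooth family of real linear
endomorphisms `J x` of the tangent spaces, with `J x ∘ J x = -1`. Smoothness is that of the
bundle map `J : TM → TM`. -/
structure AlmostComplexStructure (I : ModelWithCorners ℝ E H)
    (M : Type*) [TopologicalSpace M] [ChartedSpace H M] [IsManifold I ∞ M] where
  /-- The endomorphism of the tangent space at `x`. -/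
  toFun : ∀ x : M, TangentSpace I x →L[ℝ] TangentSpace I x
  sq_eq_neg : ∀ (x : M) (v : TangentSpace I x), toFun x (toFun x v) = -v
  smooth : ContMDiff I.tangent I.tangent ∞
    (fun v : TangentBundle I M => (⟨v.proj, toFun v.proj v.snd⟩ : TangentBundle I M))

variable {I : ModelWithCorners ℝ E H}
  {M : Type*} [TopologicalSpace M] [ChartedSpace H M] [IsManifold I ∞ M]

namespace AlmostComplexStructure

/-- The vector field `J X`. -/
def onField (J : AlmostComplexStructure I M) (X : ∀ x : M, TangentSpace I x) :
    ∀ x : M, TangentSpace I x :=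
  fun x => J.toFun x (X x)

/-- The Nijenhuis tensor `N_J(X, Y) = [JX, JY] - J[JX, Y] - J[X, JY] - [X, Y]`, evaluated on
vector fields. -/
def nijenhuis (J : AlmostComplexStructure I M) (X Y : ∀ x : M, TangentSpace I x) (x : M) :
    TangentSpace I x :=
  mlieBracket I (J.onField X) (J.onField Y) x
    - J.toFun x (mlieBracket I (J.onField X) Y x)
    - J.toFun x (mlieBracket I X (J.onField Y) x)
    - mlieBracket I X Y x

/-- `J` is integrable: it comes from a complex manifold structure, i.e. around every point there is
a smooth coordinate system with values in `ℂⁿ` whose differential intertwines `J` with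
multiplication by `i`. (Changes of such coordinates are automatically holomorphic.) -/
def Integrable (J : AlmostComplexStructure I M) : Prop :=
  ∀ p : M, ∃ (n : ℕ) (φ : OpenPartialHomeomorph M (Fin n → ℂ)),
    p ∈ φ.source ∧
    ContMDiffOn I 𝓘(ℝ, Fin n → ℂ) ∞ φ φ.source ∧
    ContMDiffOn 𝓘(ℝ, Fin n → ℂ) I ∞ φ.symm φ.target ∧
    ∀ x ∈ φ.source, ∀ v : TangentSpace I x,
      NormedSpace.fromTangentSpace (φ x) (mfderiv I 𝓘(ℝ, Fin n → ℂ) φ x (J.toFun x v)) =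
        Complex.I • NormedSpace.fromTangentSpace (φ x) (mfderiv I 𝓘(ℝ, Fin n → ℂ) φ x v)

end AlmostComplexStructure

/-- A smooth map between almost complex manifolds is pseudoholomorphic if its differential
intertwines the almost complex structures. -/
def Pseudoholomorphic {E' : Type*} [NormedAddCommGroup E'] [NormedSpace ℝ E']
    {H' : Type*} [TopologicalSpace H'] {I' : ModelWithCorners ℝ E' H'}
    {M' : Type*} [TopologicalSpace M'] [ChartedSpace H' M'] [IsManifold I' ∞ M']
    (J : AlmostComplexStructure I M) (J' : AlmostComplexStructure I' M') (f : M → M') : Prop :=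
  ContMDiff I I' ∞ f ∧
    ∀ (x : M) (v : TangentSpace I x),
      mfderiv I I' f x (J.toFun x v) = J'.toFun (f x) (mfderiv I I' f x v)

/-- A minimal connection on `(M, J)`: a smooth linear connection `∇` on `TM` with `∇J = 0` and
torsion `T_∇ = (1/4) N_J`. In Mathlib's notation `D X x v` is `∇_v X`, and `D.torsion x (X x) (Y x)`
is the value at `x` of `∇_X Y - ∇_Y X - [X, Y]`. -/
structure IsMinimalConnection [FiniteDimensional ℝ E]
    (J : AlmostComplexStructure I M)
    (D : CovariantDerivative I E (TangentSpace I : M → Type _)) : Prop where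
  smooth : D.ContMDiffCovariantDerivative ∞
  almostComplex : ∀ (X : ∀ x : M, TangentSpace I x) (x : M),
    MDifferentiableAt I I.tangent (fun y => (⟨y, X y⟩ : TangentBundle I M)) x →
    ∀ v : TangentSpace I x, D (J.onField X) x v = J.toFun x (D X x v)
  torsion_eq : ∀ (X Y : ∀ x : M, TangentSpace I x) (x : M),
    MDifferentiableAt I I.tangent (fun y => (⟨y, X y⟩ : TangentBundle I M)) x →
    MDifferentiableAt I I.tangent (fun y => (⟨y, Y y⟩ : TangentBundle I M)) x →
    haveI : CompleteSpace E := FiniteDimensional.complete ℝ E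
    D.torsion x (X x) (Y x) = (1 / 4 : ℝ) • J.nijenhuis X Y x

/-- The projection `π : TM → M`. -/
def proj (a : TangentBundle I M) : M := a.proj

/-- The zero section `ρ : M → TM`. -/
def zeroSec (x : M) : TangentBundle I M := ⟨x, 0⟩

/-- The differential `π_* : T_a(TM) → T_{π(a)} M`. -/
def dproj (a : TangentBundle I M) :
    TangentSpace I.tangent a →L[ℝ] TangentSpace I a.proj :=
  mfderiv I.tangent I (proj : TangentBundle I M → M) a

/-- The vertical space `V_a = ker π_*`. -/
def verticalSpace (a : TangentBundle I M) : Submodule ℝ (TangentSpace I.tangent a) :=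
  LinearMap.ker (dproj a).toLinearMap

/-- The vertical lift `T_{π(a)} M → T_a(TM)`: the differential at `a` of the inclusion of the fibre
through `a`, so that `v` is sent to the velocity at `t = 0` of `t ↦ a + t v`. (The fibre is, as a
vector space, the model space `E`.) -/
def verticalLift (a : TangentBundle I M) :
    TangentSpace I a.proj →L[ℝ] TangentSpace I.tangent a :=
  mfderiv 𝓘(ℝ, E) I.tangent (fun v : E => (⟨a.proj, v⟩ : TangentBundle I M)) a.snd

/-- The horizontal space `H_a` of a linear connection `∇` on `TM` at `a ∈ T_xM`: it consists of the
vectors `dY_x(u) - (∇_u Y)^{vert}`, where `u ∈ T_xM` and `Y` is a vector field with `Y x = a`;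
in particular it contains the velocities `dY_x(u)` of fields with `∇_u Y = 0`. -/
def horizontalSpace (D : CovariantDerivative I E (TangentSpace I : M → Type _))
    (a : TangentBundle I M) : Submodule ℝ (TangentSpace I.tangent a) :=
  Submodule.span ℝ
    {w | ∃ (Y : ∀ x : M, TangentSpace I x) (u : TangentSpace I a.proj),
      MDifferentiableAt I I.tangent (fun y => (⟨y, Y y⟩ : TangentBundle I M)) a.proj ∧
      ∃ h : (⟨a.proj, Y a.proj⟩ : TangentBundle I M) = a,
      w = (h ▸ mfderiv I I.tangent (fun y => (⟨y, Y y⟩ : TangentBundle I M)) a.proj u :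
            TangentSpace I.tangent a)
          - verticalLift a (D Y a.proj u)}

/-- The family `K` of endomorphisms of the tangent spaces of `TM` is `J ⊕ J` with respect to the
splittings `T_a(TM) = H_a ⊕ V_a` given by `D` and the isomorphisms `π_* : H_a ≃ T_{π(a)} M` and
`V_a ≃ T_{π(a)} M` (the inverse of the vertical lift). -/
def IsSumStructure (J : AlmostComplexStructure I M)
    (D : CovariantDerivative I E (TangentSpace I : M → Type _))
    (K : ∀ a : TangentBundle I M, TangentSpace I.tangent a →L[ℝ] TangentSpace I.tangent a) :
    Prop :=
  ∀ a : TangentBundle I M,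
    (∀ w ∈ horizontalSpace D a,
      K a w ∈ horizontalSpace D a ∧ dproj a (K a w) = J.toFun a.proj (dproj a w)) ∧
    (∀ v : TangentSpace I a.proj, K a (verticalLift a v) = verticalLift a (J.toFun a.proj v))

end General

end AlmostComplex

end

/-!
Throughout, a connection `D` on `TM` is studied through its connector: the linear maps
`connector D a : T_a(TM) → T_{π(a)} M` that send `dY(u)` to `∇_u Y`, for a field `Y` through `a`,
and invert the vertical lift. The horizontal space is the kernel of the connector
(`mem_horizontalSpace_iff`), and `(dπ, connector)` is a bijection onto `T_{π(a)} M × T_{π(a)} M`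
(`bijective_dproj_prod_connector`). This gives the splitting of `T_a(TM)`, and it turns the
condition to be `J ⊕ J` into the two equations `dπ ∘ K = J ∘ dπ` and
`connector ∘ K = J ∘ connector`, which have exactly one solution, `sumStructure D J`
(`isSumStructure_iff`).

*Existence of minimal connections.* The flat connections of the charts are patched to a smooth
connection, half of its torsion is subtracted, and the resulting torsion-free connection `∇` is
changed by the tensor `-((∇_{Jy} J) u + J (∇_y J) u + 2 J (∇_u J) y) / 4`
(`exists_isMinimalConnection`).

*Independence of the connection.* The difference `A(u, y)` of two minimal connections is `J`-linear
in the differentiated vector `y` and symmetric, as the torsions agree; so it is also `J`-linear in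
`u`. The connectors differ by `w ↦ A(dπ(w), a)`, hence the sum structures coincide
(`sumStructure_eq`). Smoothness comes from the expression of the connector in charts
(`contMDiff_connector`), and both pseudoholomorphicity claims are read off from the two equations,
the zero section being horizontal.

*Integrability.* By the inverse function theorem and a complex linear projection, a structure is
integrable as soon as there is, near each point, a smooth immersion into some `ℂⁿ` with complex
linear differential (`AlmostComplexStructure.integrable_of_immersion`). If the structure on `TM` is
integrable, holomorphic coordinates of `TM` composed with the zero section are such immersions of
`M`. Conversely, let `φ` be holomorphic coordinates of `M`. The fields that are constant in these
coordinates commute, so the Nijenhuis tensor and the torsion of a minimal connection `∇` vanish, and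
`∇_u Y` is complex linear in `u` for such fields `Y`
(`IsMinimalConnection.coordinateField_apply`). Therefore the structure on `TM` sends `dY(u)` to
`dY(Ju)`, which makes `(φ, dφ)` holomorphic on `TM` (`mvfderiv_fiberDerivative_sumStructure`).
-/

noncomputable section

open Set Bundle VectorField Filter
open scoped Manifold ContDiff Topology

namespace AlmostComplex

/-! ### Global fields and smoothness of tensors -/

section Frames

variable {E : Type*} [NormedAddCommGroup E] [NormedSpace ℝ E] [FiniteDimensional ℝ E]
  {M : Type*} [TopologicalSpace M] [T2Space M]
  [ChartedSpace E M] [IsManifold 𝓘(ℝ, E) ∞ M]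

/-- Globally defined smooth vector fields with constant components near a given point. -/
lemma exists_contMDiff_trivialization_const (x₀ : M) (v : E) :
    ∃ X : ∀ x : M, TangentSpace 𝓘(ℝ, E) x,
      ContMDiff 𝓘(ℝ, E) 𝓘(ℝ, E).tangent ∞ (fun x => (⟨x, X x⟩ : TangentBundle 𝓘(ℝ, E) M)) ∧
      ∀ᶠ x in 𝓝 x₀, (trivializationAt E (TangentSpace 𝓘(ℝ, E)) x₀ ⟨x, X x⟩).2 = v := by
  set e := trivializationAt E (TangentSpace 𝓘(ℝ, E) : M → Type _) x₀
  obtain ⟨f⟩ : Nonempty (SmoothBumpFunction 𝓘(ℝ, E) x₀) := inferInstance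
  have hs : ContMDiffOn 𝓘(ℝ, E) 𝓘(ℝ, E).tangent ∞
      (fun x => (⟨x, e.symm x v⟩ : TangentBundle 𝓘(ℝ, E) M)) e.baseSet := by
    rw [e.contMDiffOn_section_baseSet_iff]
    exact contMDiffOn_const (c := v) |>.congr fun x hx => by simp [hx]
  refine ⟨(f : M → ℝ) • fun x => e.symm x v, ?_, ?_⟩
  · exact ContMDiffOn.smul_section_of_tsupport (f.contMDiff.contMDiffOn) e.open_baseSet
      f.tsupport_subset_chartAt_source hs
  · filter_upwards [f.eventuallyEq_one, e.open_baseSet.mem_nhds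
      (FiberBundle.mem_baseSet_trivializationAt' x₀)] with x hx hxe
    have : ((f : M → ℝ) • fun x => e.symm x v) x = e.symm x v := by
      simp [hx]
    rw [this]
    simp [hxe]

/-- A field of linear maps from the tangent spaces to the fibres of a vector bundle is smooth at a
point if it maps globally defined smooth vector fields to sections that are smooth at that point. -/
lemma contMDiffAt_hom_of_apply {F : Type*} [NormedAddCommGroup F] [NormedSpace ℝ F]
    {V : M → Type*} [TopologicalSpace (TotalSpace F V)] [∀ x, AddCommGroup (V x)]
    [∀ x, Module ℝ (V x)] [∀ x, TopologicalSpace (V x)] [∀ x, IsTopologicalAddGroup (V x)]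
    [∀ x, ContinuousSMul ℝ (V x)] [FiberBundle F V] [VectorBundle ℝ F V]
    [ContMDiffVectorBundle ∞ F V 𝓘(ℝ, E)]
    {L : ∀ x : M, TangentSpace 𝓘(ℝ, E) x →L[ℝ] V x} {x₀ : M}
    (h : ∀ X : ∀ x : M, TangentSpace 𝓘(ℝ, E) x,
      ContMDiff 𝓘(ℝ, E) 𝓘(ℝ, E).tangent ∞ (fun x => (⟨x, X x⟩ : TangentBundle 𝓘(ℝ, E) M)) →
      ContMDiffAt 𝓘(ℝ, E) (𝓘(ℝ, E).prod 𝓘(ℝ, F)) ∞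
        (fun x => (⟨x, L x (X x)⟩ : TotalSpace F V)) x₀) :
    ContMDiffAt 𝓘(ℝ, E) (𝓘(ℝ, E).prod 𝓘(ℝ, E →L[ℝ] F)) ∞
      (fun x => (⟨x, L x⟩ : TotalSpace (E →L[ℝ] F)
        (fun x : M => TangentSpace 𝓘(ℝ, E) x →L[ℝ] V x))) x₀ := by
  set e := trivializationAt E (TangentSpace 𝓘(ℝ, E) : M → Type _) x₀ with he
  set e' := trivializationAt F V x₀ with he'
  let b := Module.finBasis ℝ E
  choose X hX hXb using fun i => exists_contMDiff_trivialization_const x₀ (b i)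
  rw [contMDiffAt_hom_bundle]
  refine ⟨contMDiffAt_id, ?_⟩
  have key : ContMDiffAt 𝓘(ℝ, E) 𝓘(ℝ, E →L[ℝ] F) ∞
      (fun x => ∑ i, (ContinuousLinearMap.smulRightL ℝ E F
        (LinearMap.toContinuousLinearMap (b.coord i))) (e' ⟨x, L x (X i x)⟩).2) x₀ := by
    refine ContMDiffAt.sum fun i _ => ?_
    refine (ContinuousLinearMap.contMDiff _).contMDiffAt.comp x₀ ?_
    exact (contMDiffAt_section x₀).1 (h (X i) (hX i))
  refine key.congr_of_eventuallyEq ?_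
  filter_upwards [eventually_all.2 hXb, e.open_baseSet.mem_nhds
      (FiberBundle.mem_baseSet_trivializationAt' x₀), e'.open_baseSet.mem_nhds
      (FiberBundle.mem_baseSet_trivializationAt' x₀)] with x hx hxe hxe'
  refine ContinuousLinearMap.coe_injective (b.ext fun j => ?_)
  have hj : e.symm x (b j) = X j x := by
    rw [← hx j, e.symm_apply_apply_mk hxe]
  simp [ContinuousLinearMap.inCoordinates, ← he, ← he', hxe, hxe', hj, Finsupp.single_apply]

end Frames

/-! ### Flat connections of charts and existence of connections -/

section Derivative

variable {E : Type*} [NormedAddCommGroup E] [NormedSpace ℝ E]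
  {H : Type*} [TopologicalSpace H] {I : ModelWithCorners ℝ E H}
  {M : Type*} [TopologicalSpace M] [ChartedSpace H M]
  {F : Type*} [NormedAddCommGroup F] [NormedSpace ℝ F]

lemma mvfderiv_congr {f g : M → F} {x : M} (h : f =ᶠ[𝓝 x] g) :
    mvfderiv I f x = mvfderiv I g x := by
  ext v
  exact DFunLike.congr_fun (h.mfderiv_eq (I := I) (I' := 𝓘(ℝ, F))) v

/-- The derivative of a smooth vector-valued function is smooth on the tangent bundle. -/
lemma contMDiffOn_mvfderiv [IsManifold I ∞ M] {f : M → F} {s : Set M} (hs : IsOpen s)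
    (hf : ContMDiffOn I 𝓘(ℝ, F) ∞ f s) :
    ContMDiffOn I.tangent 𝓘(ℝ, F) ∞
      (fun a : TangentBundle I M => mvfderiv I f a.proj a.snd)
      (TotalSpace.proj ⁻¹' s) := by
  have h := hf.contMDiffOn_tangentMapWithin (m := ∞) (by simp) hs.uniqueMDiffOn
  refine (contMDiff_snd_tangentBundle_modelSpace F 𝓘(ℝ, F)).comp_contMDiffOn h |>.congr ?_
  rintro a ha
  exact (DFunLike.congr_fun (mfderivWithin_of_isOpen (I := I) (I' := 𝓘(ℝ, F)) (f := f)
    hs ha) a.snd).symm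

end Derivative

section FlatConnection

variable {E : Type*} [NormedAddCommGroup E] [NormedSpace ℝ E]
  {M : Type*} [TopologicalSpace M] [ChartedSpace E M] [IsManifold 𝓘(ℝ, E) ∞ M]

/-- The flat connection of the chart at `x₀`: differentiation of the components of a vector field
in the trivialization of the tangent bundle at `x₀`. It is only meaningful on the domain of that
chart. -/
def flatConnection (x₀ : M) (Y : ∀ x : M, TangentSpace 𝓘(ℝ, E) x) (x : M) :
    TangentSpace 𝓘(ℝ, E) x →L[ℝ] TangentSpace 𝓘(ℝ, E) x :=
  ((trivializationAt E (TangentSpace 𝓘(ℝ, E)) x₀).symmL ℝ x).comp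
    (mvfderiv 𝓘(ℝ, E)
      (fun y => (trivializationAt E (TangentSpace 𝓘(ℝ, E)) x₀ ⟨y, Y y⟩).2) x)

lemma isCovariantDerivativeOn_flatConnection (x₀ : M) :
    IsCovariantDerivativeOn (I := 𝓘(ℝ, E)) E (flatConnection x₀) (chartAt E x₀).source := by
  set e := trivializationAt E (TangentSpace 𝓘(ℝ, E) : M → Type _) x₀
  constructor
  · intro Y Y' x hY hY' hx
    have hx' : x ∈ e.baseSet := hx
    rw [e.mdifferentiableAt_section_iff 𝓘(ℝ, E) _ hx'] at hY hY'
    have : (fun y => (e ⟨y, (Y + Y') y⟩).2) =ᶠ[𝓝 x]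
        (fun y => (e ⟨y, Y y⟩).2) + (fun y => (e ⟨y, Y' y⟩).2) := by
      filter_upwards [e.open_baseSet.mem_nhds hx'] with y hy
      simpa using (e.linear ℝ hy).map_add (Y y) (Y' y)
    have hd := (mvfderiv_congr this).trans (mvfderiv_add hY hY')
    ext v
    change e.symmL ℝ x (mvfderiv 𝓘(ℝ, E) (fun y => (e ⟨y, (Y + Y') y⟩).2) x v) =
      e.symmL ℝ x (mvfderiv 𝓘(ℝ, E) (fun y => (e ⟨y, Y y⟩).2) x v) +
        e.symmL ℝ x (mvfderiv 𝓘(ℝ, E) (fun y => (e ⟨y, Y' y⟩).2) x v)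
    rw [hd, ← map_add]
    rfl
  · intro Y g x hY hg hx
    have hx' : x ∈ e.baseSet := hx
    rw [e.mdifferentiableAt_section_iff 𝓘(ℝ, E) _ hx'] at hY
    have : (fun y => (e ⟨y, (g • Y) y⟩).2) =ᶠ[𝓝 x]
        g • (fun y => (e ⟨y, Y y⟩).2) := by
      filter_upwards [e.open_baseSet.mem_nhds hx'] with y hy
      simpa using (e.linear ℝ hy).map_smul (g y) (Y y)
    have hd := (mvfderiv_congr this).trans (mvfderiv_smul hg hY)
    ext v
    change e.symmL ℝ x (mvfderiv 𝓘(ℝ, E) (fun y => (e ⟨y, (g • Y) y⟩).2) x v) =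
      g x • e.symmL ℝ x (mvfderiv 𝓘(ℝ, E) (fun y => (e ⟨y, Y y⟩).2) x v) +
        mvfderiv 𝓘(ℝ, E) g x v • Y x
    have hY : e.symmL ℝ x (e ⟨x, Y x⟩).2 = Y x := by simp [hx']
    rw [hd]
    change e.symmL ℝ x (g x • mvfderiv 𝓘(ℝ, E) (fun y => (e ⟨y, Y y⟩).2) x v +
      mvfderiv 𝓘(ℝ, E) g x v • (e ⟨x, Y x⟩).2) = _
    rw [map_add, map_smul, map_smul, hY]

lemma trivializationAt_flatConnection (x₀ : M) (Y : ∀ x : M, TangentSpace 𝓘(ℝ, E) x) {x : M}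
    (hx : x ∈ (chartAt E x₀).source) (v : TangentSpace 𝓘(ℝ, E) x) :
    (trivializationAt E (TangentSpace 𝓘(ℝ, E)) x₀ ⟨x, flatConnection x₀ Y x v⟩).2 =
      mvfderiv 𝓘(ℝ, E)
        (fun y => (trivializationAt E (TangentSpace 𝓘(ℝ, E)) x₀ ⟨y, Y y⟩).2) x v := by
  set e := trivializationAt E (TangentSpace 𝓘(ℝ, E) : M → Type _) x₀ with he
  have hx' : x ∈ e.baseSet := hx
  simp [flatConnection, ← he, hx']

lemma contMDiffOn_flatConnection [FiniteDimensional ℝ E] [T2Space M]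
    (x₀ : M) {Y : ∀ x : M, TangentSpace 𝓘(ℝ, E) x}
    (hY : ContMDiff 𝓘(ℝ, E) 𝓘(ℝ, E).tangent ∞ (fun x => (⟨x, Y x⟩ : TangentBundle 𝓘(ℝ, E) M))) :
    ContMDiffOn 𝓘(ℝ, E) (𝓘(ℝ, E).prod 𝓘(ℝ, E →L[ℝ] E)) ∞
      (fun x => (⟨x, flatConnection x₀ Y x⟩ : TotalSpace (E →L[ℝ] E)
        (fun x : M => TangentSpace 𝓘(ℝ, E) x →L[ℝ] TangentSpace 𝓘(ℝ, E) x)))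
      (chartAt E x₀).source := by
  set e := trivializationAt E (TangentSpace 𝓘(ℝ, E) : M → Type _) x₀
  intro x hx
  have hx' : x ∈ e.baseSet := hx
  refine (contMDiffAt_hom_of_apply fun X hX => ?_).contMDiffWithinAt
  rw [e.contMDiffAt_section_iff hx']
  have h1 : ContMDiffOn 𝓘(ℝ, E) 𝓘(ℝ, E) ∞ (fun y => (e ⟨y, Y y⟩).2) e.baseSet :=
    e.contMDiffOn_section_baseSet_iff.1 hY.contMDiffOn
  have h2 := (contMDiffOn_mvfderiv e.open_baseSet h1).comp hX.contMDiffOn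
    (s := e.baseSet) (fun y hy => hy)
  refine (h2.contMDiffAt (e.open_baseSet.mem_nhds hx')).congr_of_eventuallyEq ?_
  filter_upwards [e.open_baseSet.mem_nhds hx'] with y hy
  exact trivializationAt_flatConnection x₀ Y hy (X y)

end FlatConnection

section Existence

variable {E : Type*} [NormedAddCommGroup E] [NormedSpace ℝ E] [FiniteDimensional ℝ E]
  {M : Type*} [TopologicalSpace M] [T2Space M] [SigmaCompactSpace M]
  [ChartedSpace E M] [IsManifold 𝓘(ℝ, E) ∞ M]

variable (E M) in
/-- Smooth connections exist: a partition of unity patches the flat connections of the charts. -/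
theorem exists_contMDiffCovariantDerivative :
    ∃ D : CovariantDerivative 𝓘(ℝ, E) E (TangentSpace 𝓘(ℝ, E) : M → Type _),
      D.ContMDiffCovariantDerivative ∞ := by
  obtain ⟨f, hf⟩ := SmoothPartitionOfUnity.exists_isSubordinate_chartAt_source 𝓘(ℝ, E) M
  have hsupp : ∀ (Y : ∀ x : M, TangentSpace 𝓘(ℝ, E) x) (x : M),
      Function.support (fun i => f i x • flatConnection i Y x) ⊆ (f.finsupport x : Set M) := by
    intro Y x i hi
    rw [f.coe_finsupport]
    intro h
    exact hi (by simp [show f i x = 0 from h])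
  have hsum : ∀ (Y : ∀ x : M, TangentSpace 𝓘(ℝ, E) x) (x : M),
      ∑ᶠ i, f i x • flatConnection i Y x = ∑ i ∈ f.finsupport x, f i x • flatConnection i Y x :=
    fun Y x => finsum_eq_sum_of_support_subset _ (hsupp Y x)
  have hmem : ∀ {x i}, i ∈ f.finsupport x → x ∈ (chartAt E i).source := by
    intro x i hi
    rw [f.mem_finsupport] at hi
    exact hf i (subset_tsupport _ hi)
  refine ⟨⟨fun Y x => ∑ᶠ i, f i x • flatConnection i Y x, ?_, ?_⟩, ⟨⟨?_⟩⟩⟩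
  · intro Y Y' x hY hY' _
    simp only [hsum, ← Finset.sum_add_distrib]
    refine Finset.sum_congr rfl fun i hi => ?_
    rw [(isCovariantDerivativeOn_flatConnection i).add hY hY' (hmem hi), smul_add]
  · intro Y g x hY hg _
    simp only [hsum]
    have h1 : ∀ i ∈ f.finsupport x, f i x • flatConnection i (g • Y) x =
        g x • (f i x • flatConnection i Y x) +
          f i x • (mvfderiv 𝓘(ℝ, E) g x).smulRight (Y x) := fun i hi => by
      rw [(isCovariantDerivativeOn_flatConnection i).leibniz hY hg (hmem hi), smul_add, smul_comm]
    rw [Finset.sum_congr rfl h1, Finset.sum_add_distrib, ← Finset.smul_sum, ← Finset.sum_smul,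
      f.sum_finsupport x (mem_univ x), one_smul]
  · intro Y hY
    rw [contMDiffOn_univ] at hY ⊢
    refine ContMDiff.finsum_section_of_locallyFinite
      (V := fun x : M => TangentSpace 𝓘(ℝ, E) x →L[ℝ] TangentSpace 𝓘(ℝ, E) x) ?_ fun i => ?_
    · refine f.locallyFinite.subset fun i x hx h => hx ?_
      simp [show f i x = 0 from h]
    · exact ContMDiffOn.smul_section_of_tsupport
        (V := fun x : M => TangentSpace 𝓘(ℝ, E) x →L[ℝ] TangentSpace 𝓘(ℝ, E) x)
        (f i).contMDiff.contMDiffOn (chartAt E i).open_source (hf i)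
        (contMDiffOn_flatConnection i (by simpa using hY))

end Existence

/-! ### Existence of minimal connections -/

section MinimalConnection

variable {E : Type*} [NormedAddCommGroup E] [NormedSpace ℝ E]
  {M : Type*} [TopologicalSpace M] [ChartedSpace E M] [IsManifold 𝓘(ℝ, E) ∞ M]

namespace AlmostComplexStructure

variable (J : AlmostComplexStructure 𝓘(ℝ, E) M)

lemma contMDiff_onField {X : ∀ x : M, TangentSpace 𝓘(ℝ, E) x}
    (hX : ContMDiff 𝓘(ℝ, E) 𝓘(ℝ, E).tangent ∞ (fun x => (⟨x, X x⟩ : TangentBundle 𝓘(ℝ, E) M))) :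
    ContMDiff 𝓘(ℝ, E) 𝓘(ℝ, E).tangent ∞
      (fun x => (⟨x, J.onField X x⟩ : TangentBundle 𝓘(ℝ, E) M)) :=
  J.smooth.comp hX

lemma mdifferentiableAt_onField {X : ∀ x : M, TangentSpace 𝓘(ℝ, E) x} {x : M}
    (hX : MDifferentiableAt 𝓘(ℝ, E) 𝓘(ℝ, E).tangent
      (fun x => (⟨x, X x⟩ : TangentBundle 𝓘(ℝ, E) M)) x) :
    MDifferentiableAt 𝓘(ℝ, E) 𝓘(ℝ, E).tangent
      (fun x => (⟨x, J.onField X x⟩ : TangentBundle 𝓘(ℝ, E) M)) x :=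
  (J.smooth.mdifferentiable (by simp) _).comp x hX

lemma onField_onField (X : ∀ x : M, TangentSpace 𝓘(ℝ, E) x) : J.onField (J.onField X) = -X := by
  funext x
  simp [onField, J.sq_eq_neg]

lemma onField_apply (X : ∀ x : M, TangentSpace 𝓘(ℝ, E) x) (x : M) :
    J.onField X x = J.toFun x (X x) := rfl

/-- The expression `∇(JY) - J ∇Y` is tensorial in `Y`. -/
lemma tensorialAt_covariantDerivative
    (D : CovariantDerivative 𝓘(ℝ, E) E (TangentSpace 𝓘(ℝ, E) : M → Type _)) (x : M) :
    TensorialAt 𝓘(ℝ, E) E (fun Y : ∀ x : M, TangentSpace 𝓘(ℝ, E) x =>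
      D (J.onField Y) x - (J.toFun x).comp (D Y x)) x where
  smul {f Y} hf hY := by
    have h : J.onField (f • Y) = f • J.onField Y := by
      funext y
      simp [onField]
    rw [h, D.isCovariantDerivativeOnUniv.leibniz (J.mdifferentiableAt_onField hY) hf,
      D.isCovariantDerivativeOnUniv.leibniz hY hf]
    ext v
    simp [onField]
    module
  add {Y Y'} hY hY' := by
    have h : J.onField (Y + Y') = J.onField Y + J.onField Y' := by
      funext y
      simp [onField]
    rw [h, D.isCovariantDerivativeOnUniv.add (J.mdifferentiableAt_onField hY)
      (J.mdifferentiableAt_onField hY'), D.isCovariantDerivativeOnUniv.add hY hY']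
    ext v
    simp
    module

end AlmostComplexStructure

instance (x : M) [FiniteDimensional ℝ E] : FiniteDimensional ℝ (TangentSpace 𝓘(ℝ, E) x) :=
  inferInstanceAs (FiniteDimensional ℝ E)

instance (x : M) : T2Space (TangentSpace 𝓘(ℝ, E) x) :=
  inferInstanceAs (T2Space E)

lemma contMDiff_covariantDerivative_apply
    {D : CovariantDerivative 𝓘(ℝ, E) E (TangentSpace 𝓘(ℝ, E) : M → Type _)}
    (hD : D.ContMDiffCovariantDerivative ∞) {X Y : ∀ x : M, TangentSpace 𝓘(ℝ, E) x}
    (hX : ContMDiff 𝓘(ℝ, E) 𝓘(ℝ, E).tangent ∞ (fun x => (⟨x, X x⟩ : TangentBundle 𝓘(ℝ, E) M)))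
    (hY : ContMDiff 𝓘(ℝ, E) 𝓘(ℝ, E).tangent ∞ (fun x => (⟨x, Y x⟩ : TangentBundle 𝓘(ℝ, E) M))) :
    ContMDiff 𝓘(ℝ, E) 𝓘(ℝ, E).tangent ∞
      (fun x => (⟨x, D Y x (X x)⟩ : TangentBundle 𝓘(ℝ, E) M)) := by
  have h := hD.contMDiff.contMDiff (σ := Y) (by simpa using hY.contMDiffOn)
  rw [contMDiffOn_univ] at h
  exact h.clm_bundle_apply hX

variable [FiniteDimensional ℝ E]

lemma contMDiffCovariantDerivative_addOneForm [T2Space M]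
    {D : CovariantDerivative 𝓘(ℝ, E) E (TangentSpace 𝓘(ℝ, E) : M → Type _)}
    (hD : D.ContMDiffCovariantDerivative ∞)
    (A : ∀ x : M, TangentSpace 𝓘(ℝ, E) x →L[ℝ] TangentSpace 𝓘(ℝ, E) x →L[ℝ]
      TangentSpace 𝓘(ℝ, E) x)
    (hA : ∀ X Y : ∀ x : M, TangentSpace 𝓘(ℝ, E) x,
      ContMDiff 𝓘(ℝ, E) 𝓘(ℝ, E).tangent ∞ (fun x => (⟨x, X x⟩ : TangentBundle 𝓘(ℝ, E) M)) →
      ContMDiff 𝓘(ℝ, E) 𝓘(ℝ, E).tangent ∞ (fun x => (⟨x, Y x⟩ : TangentBundle 𝓘(ℝ, E) M)) →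
      ContMDiff 𝓘(ℝ, E) 𝓘(ℝ, E).tangent ∞
        (fun x => (⟨x, A x (Y x) (X x)⟩ : TangentBundle 𝓘(ℝ, E) M))) :
    (D.addOneForm A).ContMDiffCovariantDerivative ∞ := by
  refine ⟨⟨fun {Y} hY => ?_⟩⟩
  have hY' : ContMDiff 𝓘(ℝ, E) 𝓘(ℝ, E).tangent ∞
    (fun x => (⟨x, Y x⟩ : TangentBundle 𝓘(ℝ, E) M)) := by
    simpa [contMDiffOn_univ] using hY
  rw [contMDiffOn_univ]
  intro x
  refine contMDiffAt_hom_of_apply fun X hX => ?_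
  exact ((contMDiff_covariantDerivative_apply hD hX hY').add_section (hA X Y hX hY')) x

variable (E M) in
/-- Subtracting half of its torsion makes any smooth connection torsion-free. -/
theorem exists_torsionFree [T2Space M] [SigmaCompactSpace M] :
    ∃ D : CovariantDerivative 𝓘(ℝ, E) E (TangentSpace 𝓘(ℝ, E) : M → Type _),
      D.ContMDiffCovariantDerivative ∞ ∧
      ∀ (X Y : ∀ x : M, TangentSpace 𝓘(ℝ, E) x) (x : M),
        MDifferentiableAt 𝓘(ℝ, E) 𝓘(ℝ, E).tangent
          (fun y => (⟨y, X y⟩ : TangentBundle 𝓘(ℝ, E) M)) x →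
        MDifferentiableAt 𝓘(ℝ, E) 𝓘(ℝ, E).tangent
          (fun y => (⟨y, Y y⟩ : TangentBundle 𝓘(ℝ, E) M)) x →
        mlieBracket 𝓘(ℝ, E) X Y x = D Y x (X x) - D X x (Y x) := by
  have : CompleteSpace E := FiniteDimensional.complete ℝ E
  obtain ⟨D, hD⟩ := exists_contMDiffCovariantDerivative E M
  -- The torsion is alternating, so `-T(X, Y) / 2` is `T(Y, X) / 2`, with the argument that is
  -- differentiated in first place, as `addOneForm` expects it.
  refine ⟨D.addOneForm fun x => (1 / 2 : ℝ) • D.torsion x, ?_, ?_⟩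
  · refine contMDiffCovariantDerivative_addOneForm hD _ fun X Y hX hY => ?_
    have h1 := contMDiff_covariantDerivative_apply hD hX hY
    have h2 := contMDiff_covariantDerivative_apply hD hY hX
    have h3 : ContMDiff 𝓘(ℝ, E) 𝓘(ℝ, E).tangent ∞
        (fun x => (⟨x, mlieBracket 𝓘(ℝ, E) Y X x⟩ : TangentBundle 𝓘(ℝ, E) M)) := by
      have : IsManifold 𝓘(ℝ, E) (((⊤ : ℕ∞) : WithTop ℕ∞) + 1) M := by simpa
      have : IsManifold 𝓘(ℝ, E) (minSmoothness ℝ 2) M := by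
        rw [minSmoothness_of_isRCLikeNormedField]
        infer_instance
      exact fun x => ContMDiffAt.mlieBracket_vectorField (n := (⊤ : ℕ∞)) (m := (⊤ : ℕ∞))
        (hY x) (hX x) (by simp)
    refine (ContMDiff.const_smul_section (a := (1 / 2 : ℝ))
      ((h2.sub_section h1).sub_section h3)).congr fun x => ?_
    have := D.torsion_apply (hY.mdifferentiable (by simp) x) (hX.mdifferentiable (by simp) x)
    simp only [_root_.smul_apply, this]
    rfl
  · intro X Y x hX hY
    have h1 := D.torsion_apply hX hY
    have h2 := D.torsion_antisymm (X x) (Y x)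
    change _ = (D Y x (X x) + (1 / 2 : ℝ) • D.torsion x (Y x) (X x)) -
      (D X x (Y x) + (1 / 2 : ℝ) • D.torsion x (X x) (Y x))
    have h3 : D.torsion x (Y x) (X x) = -D.torsion x (X x) (Y x) := by rw [h2, neg_neg]
    rw [h3, h1]
    module

namespace AlmostComplexStructure

variable (J : AlmostComplexStructure 𝓘(ℝ, E) M)
  (D : CovariantDerivative 𝓘(ℝ, E) E (TangentSpace 𝓘(ℝ, E) : M → Type _))

/-- The covariant derivative of `J`: `J.covDeriv D x y v` is `(∇_v J) y`. -/
def covDeriv (x : M) :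
    TangentSpace 𝓘(ℝ, E) x →L[ℝ] TangentSpace 𝓘(ℝ, E) x →L[ℝ] TangentSpace 𝓘(ℝ, E) x :=
  TensorialAt.mkHom _ x (J.tensorialAt_covariantDerivative D x)

lemma covDeriv_apply {Y : ∀ x : M, TangentSpace 𝓘(ℝ, E) x} {x : M}
    (hY : MDifferentiableAt 𝓘(ℝ, E) 𝓘(ℝ, E).tangent
      (fun x => (⟨x, Y x⟩ : TangentBundle 𝓘(ℝ, E) M)) x) (v : TangentSpace 𝓘(ℝ, E) x) :
    J.covDeriv D x (Y x) v = D (J.onField Y) x v - J.toFun x (D Y x v) := by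
  unfold covDeriv
  rw [TensorialAt.mkHom_apply (J.tensorialAt_covariantDerivative D x) hY]
  rfl

/-- The derivative of `J ^ 2 = -1`. -/
lemma covDeriv_toFun (x : M) (y v : TangentSpace 𝓘(ℝ, E) x) :
    J.covDeriv D x (J.toFun x y) v = -J.toFun x (J.covDeriv D x y v) := by
  have hY := FiberBundle.mdifferentiableAt_extend 𝓘(ℝ, E) E y
  have h1 := J.covDeriv_apply D hY v
  have h2 := J.covDeriv_apply D (J.mdifferentiableAt_onField hY) v
  have h3 : D (-FiberBundle.extend E y) x = -D (FiberBundle.extend E y) x := by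
    have := D.isCovariantDerivativeOnUniv.smul_const (-1 : ℝ) hY
    simpa using this
  rw [J.onField_onField, h3] at h2
  simp only [onField_apply, FiberBundle.extend_apply_self] at h1 h2
  rw [h1, h2]
  simp [J.sq_eq_neg, sub_eq_add_neg]

/-- The correction `A(u, y) = -((∇_{Jy} J) u + J (∇_y J) u + 2 J (∇_u J) y) / 4` which turns a
torsion-free connection into a minimal one; the vector `y` that is differentiated is the first
argument. -/
def minimalCorrection (x : M) :
    TangentSpace 𝓘(ℝ, E) x →L[ℝ] TangentSpace 𝓘(ℝ, E) x →L[ℝ] TangentSpace 𝓘(ℝ, E) x :=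
  (LinearMap.mk₂ ℝ (fun y u : TangentSpace 𝓘(ℝ, E) x =>
    (-1 / 4 : ℝ) • (J.covDeriv D x u (J.toFun x y) + J.toFun x (J.covDeriv D x u y) +
      (2 : ℝ) • J.toFun x (J.covDeriv D x y u)))
    (fun _ _ _ => by simp only [map_add, _root_.add_apply]; module)
    (fun _ _ _ => by simp only [map_smul, _root_.smul_apply]; module)
    (fun _ _ _ => by simp only [map_add, _root_.add_apply]; module)
    (fun _ _ _ => by
      simp only [map_smul, _root_.smul_apply]; module)).toContinuousBilinearMap

lemma minimalCorrection_apply (x : M) (y u : TangentSpace 𝓘(ℝ, E) x) :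
    J.minimalCorrection D x y u =
    (-1 / 4 : ℝ) • (J.covDeriv D x u (J.toFun x y) + J.toFun x (J.covDeriv D x u y) +
      (2 : ℝ) • J.toFun x (J.covDeriv D x y u)) := rfl

end AlmostComplexStructure

/-- Every almost complex manifold has a minimal connection. With `B(v, y) = (∇_v J) y` for a
torsion-free connection `∇`, both required identities for `∇ + A` follow by expansion from
`B(v, Jy) = -J B(v, y)` and the expression of the Nijenhuis tensor in terms of `∇`. -/
theorem exists_isMinimalConnection [T2Space M] [SigmaCompactSpace M]
    (J : AlmostComplexStructure 𝓘(ℝ, E) M) :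
    ∃ D : CovariantDerivative 𝓘(ℝ, E) E (TangentSpace 𝓘(ℝ, E) : M → Type _),
      IsMinimalConnection J D := by
  obtain ⟨D, hD, hT⟩ := exists_torsionFree E M
  have hB : ∀ X Y : ∀ x : M, TangentSpace 𝓘(ℝ, E) x,
      ContMDiff 𝓘(ℝ, E) 𝓘(ℝ, E).tangent ∞ (fun x => (⟨x, X x⟩ : TangentBundle 𝓘(ℝ, E) M)) →
      ContMDiff 𝓘(ℝ, E) 𝓘(ℝ, E).tangent ∞ (fun x => (⟨x, Y x⟩ : TangentBundle 𝓘(ℝ, E) M)) →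
      ContMDiff 𝓘(ℝ, E) 𝓘(ℝ, E).tangent ∞
        (fun x => (⟨x, J.covDeriv D x (Y x) (X x)⟩ : TangentBundle 𝓘(ℝ, E) M)) := by
    intro X Y hX hY
    refine ((contMDiff_covariantDerivative_apply hD hX (J.contMDiff_onField hY)).sub_section
      (J.contMDiff_onField (contMDiff_covariantDerivative_apply hD hX hY))).congr fun x => ?_
    rw [J.covDeriv_apply D (hY.mdifferentiable (by simp) x)]
    rfl
  refine ⟨D.addOneForm (J.minimalCorrection D), ?_, ?_, ?_⟩
  · refine contMDiffCovariantDerivative_addOneForm hD _ fun X Y hX hY => ?_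
    exact ContMDiff.const_smul_section (a := (-1 / 4 : ℝ))
      (((hB _ _ (J.contMDiff_onField hY) hX).add_section
        (J.contMDiff_onField (hB _ _ hY hX))).add_section
        (ContMDiff.const_smul_section (a := (2 : ℝ)) (J.contMDiff_onField (hB _ _ hX hY))))
  · intro Y x hY v
    change D (J.onField Y) x v + J.minimalCorrection D x (J.toFun x (Y x)) v =
      J.toFun x (D Y x v + J.minimalCorrection D x (Y x) v)
    have h := J.covDeriv_apply D hY v
    rw [sub_eq_iff_eq_add'.1 h.symm]
    simp only [J.minimalCorrection_apply, J.covDeriv_toFun, J.sq_eq_neg, map_add, map_smul,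
      map_neg]
    module
  · intro X Y x hX hY
    have : CompleteSpace E := FiniteDimensional.complete ℝ E
    have hJX := J.mdifferentiableAt_onField hX
    have hJY := J.mdifferentiableAt_onField hY
    have h1 := fun v => sub_eq_iff_eq_add'.1 (J.covDeriv_apply D hX v).symm
    have h2 := fun v => sub_eq_iff_eq_add'.1 (J.covDeriv_apply D hY v).symm
    rw [CovariantDerivative.torsion_apply _ hX hY]
    simp only [AlmostComplexStructure.nijenhuis, hT _ _ x hX hY, hT _ _ x hJX hJY, hT _ _ x hX hJY,
      hT _ _ x hJX hY, h1, h2, J.onField_apply]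
    change D Y x (X x) + J.minimalCorrection D x (Y x) (X x) -
      (D X x (Y x) + J.minimalCorrection D x (X x) (Y x)) - _ = _
    simp only [J.minimalCorrection_apply, map_add, map_sub, J.sq_eq_neg]
    module

end MinimalConnection

/-! ### The tangent spaces of the tangent bundle -/

section TangentOfTangent

variable {E : Type*} [NormedAddCommGroup E] [NormedSpace ℝ E]
  {M : Type*} [TopologicalSpace M] [ChartedSpace E M] [IsManifold 𝓘(ℝ, E) ∞ M]
  {F : Type*} [NormedAddCommGroup F] [NormedSpace ℝ F]

instance (a : TangentBundle 𝓘(ℝ, E) M) [FiniteDimensional ℝ E] :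
    FiniteDimensional ℝ (TangentSpace 𝓘(ℝ, E).tangent a) :=
  inferInstanceAs (FiniteDimensional ℝ (E × E))

instance (a : TangentBundle 𝓘(ℝ, E) M) : T2Space (TangentSpace 𝓘(ℝ, E).tangent a) :=
  inferInstanceAs (T2Space (E × E))

lemma mvfderiv_comp_mfderiv {N N' H H' G G' : Type*}
    [NormedAddCommGroup G] [NormedSpace ℝ G] [TopologicalSpace H] {K : ModelWithCorners ℝ G H}
    [NormedAddCommGroup G'] [NormedSpace ℝ G'] [TopologicalSpace H'] {K' : ModelWithCorners ℝ G' H'}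
    [TopologicalSpace N] [ChartedSpace H N] [TopologicalSpace N'] [ChartedSpace H' N']
    {g : N' → F} {f : N → N'} (x : N)
    (hg : MDifferentiableAt K' 𝓘(ℝ, F) g (f x)) (hf : MDifferentiableAt K K' f x)
    (v : TangentSpace K x) :
    mvfderiv K' g (f x) (mfderiv K K' f x v) = mvfderiv K (fun y => g (f y)) x v := by
  exact (mfderiv_comp_apply x hg hf v).symm

lemma contMDiff_fiberInclusion (x : M) :
    ContMDiff 𝓘(ℝ, E) 𝓘(ℝ, E).tangent ∞ (fun v : E => (⟨x, v⟩ : TangentBundle 𝓘(ℝ, E) M)) := by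
  intro v
  rw [contMDiffAt_totalSpace]
  refine ⟨contMDiffAt_const, ?_⟩
  set e := trivializationAt E (TangentSpace 𝓘(ℝ, E) : M → Type _) x
  have hx : x ∈ e.baseSet := FiberBundle.mem_baseSet_trivializationAt' x
  let L : E →L[ℝ] E := e.continuousLinearMapAt ℝ x
  refine L.contMDiff.contMDiffAt.congr_of_eventuallyEq (Eventually.of_forall fun w => ?_)
  exact (congrFun (e.coe_linearMapAt_of_mem hx) w).symm

/-- The first derivative of a vector-valued function `φ` on `M`, as a function on `TM`. -/
def fiberDerivative (φ : M → F) (a : TangentBundle 𝓘(ℝ, E) M) : F :=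
  mvfderiv 𝓘(ℝ, E) φ a.proj a.snd

variable {φ : M → F} {U : Set M}

lemma mdifferentiableAt_proj (a : TangentBundle 𝓘(ℝ, E) M) :
    MDifferentiableAt 𝓘(ℝ, E).tangent 𝓘(ℝ, E) (proj : TangentBundle 𝓘(ℝ, E) M → M) a :=
  Bundle.mdifferentiableAt_proj (TangentSpace 𝓘(ℝ, E))

lemma mvfderiv_comp_proj (a : TangentBundle 𝓘(ℝ, E) M)
    (hφ : MDifferentiableAt 𝓘(ℝ, E) 𝓘(ℝ, F) φ a.proj) (w : TangentSpace 𝓘(ℝ, E).tangent a) :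
    mvfderiv 𝓘(ℝ, E).tangent (fun b : TangentBundle 𝓘(ℝ, E) M => φ b.proj) a w =
      mvfderiv 𝓘(ℝ, E) φ a.proj (dproj a w) :=
  (mvfderiv_comp_mfderiv a hφ (mdifferentiableAt_proj a) w).symm

lemma dproj_verticalLift (a : TangentBundle 𝓘(ℝ, E) M) (v : TangentSpace 𝓘(ℝ, E) a.proj) :
    dproj a (verticalLift a v) = 0 := by
  have h := mfderiv_comp_apply (I := 𝓘(ℝ, E)) (I' := 𝓘(ℝ, E).tangent) (I'' := 𝓘(ℝ, E))
    (f := fun v : E => (⟨a.proj, v⟩ : TangentBundle 𝓘(ℝ, E) M)) (x := a.snd)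
    (g := (proj : TangentBundle 𝓘(ℝ, E) M → M))
    (mdifferentiableAt_proj _) ((contMDiff_fiberInclusion a.proj).mdifferentiable (by simp) _) v
  have h0 : mfderiv 𝓘(ℝ, E) 𝓘(ℝ, E) (fun _ : E => a.proj) (show E from a.snd) = 0 := mfderiv_const
  exact h.symm.trans (DFunLike.congr_fun h0 v)

lemma dproj_mfderiv_section {Y : ∀ x : M, TangentSpace 𝓘(ℝ, E) x} {x : M}
    (hY : MDifferentiableAt 𝓘(ℝ, E) 𝓘(ℝ, E).tangent
      (fun y => (⟨y, Y y⟩ : TangentBundle 𝓘(ℝ, E) M)) x) (u : TangentSpace 𝓘(ℝ, E) x) :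
    dproj (⟨x, Y x⟩ : TangentBundle 𝓘(ℝ, E) M)
      (mfderiv 𝓘(ℝ, E) 𝓘(ℝ, E).tangent (fun y => (⟨y, Y y⟩ : TangentBundle 𝓘(ℝ, E) M)) x u) = u := by
  have h := mfderiv_comp_apply (I := 𝓘(ℝ, E)) (I' := 𝓘(ℝ, E).tangent) (I'' := 𝓘(ℝ, E)) x
    (mdifferentiableAt_proj (⟨x, Y x⟩ : TangentBundle 𝓘(ℝ, E) M)) hY u
  refine h.symm.trans ?_
  have : (proj : TangentBundle 𝓘(ℝ, E) M → M) ∘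
      (fun y => (⟨y, Y y⟩ : TangentBundle 𝓘(ℝ, E) M)) = id := rfl
  rw [this, mfderiv_id]
  rfl

lemma mdifferentiableAt_fiberDerivative (hU : IsOpen U)
    (hφ : ContMDiffOn 𝓘(ℝ, E) 𝓘(ℝ, F) ∞ φ U) {a : TangentBundle 𝓘(ℝ, E) M} (ha : a.proj ∈ U) :
    MDifferentiableAt 𝓘(ℝ, E).tangent 𝓘(ℝ, F) (fiberDerivative φ) a :=
  ((contMDiffOn_mvfderiv hU hφ).contMDiffAt
    ((hU.preimage (FiberBundle.continuous_proj E _)).mem_nhds ha)).mdifferentiableAt (by simp)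

/-- On a fibre of `TM` the function `dφ` is linear, so it is its own derivative there. -/
lemma mvfderiv_fiberDerivative_verticalLift (hU : IsOpen U)
    (hφ : ContMDiffOn 𝓘(ℝ, E) 𝓘(ℝ, F) ∞ φ U) {a : TangentBundle 𝓘(ℝ, E) M} (ha : a.proj ∈ U)
    (v : TangentSpace 𝓘(ℝ, E) a.proj) :
    mvfderiv 𝓘(ℝ, E).tangent (fiberDerivative φ) a (verticalLift a v) =
      mvfderiv 𝓘(ℝ, E) φ a.proj v := by
  refine (mvfderiv_comp_mfderiv (K := 𝓘(ℝ, E)) (K' := 𝓘(ℝ, E).tangent)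
    (f := fun v : E => (⟨a.proj, v⟩ : TangentBundle 𝓘(ℝ, E) M)) a.snd
    (mdifferentiableAt_fiberDerivative hU hφ ha)
    ((contMDiff_fiberInclusion a.proj).mdifferentiable (by simp) _) v).trans ?_
  let L : E →L[ℝ] F := mvfderiv 𝓘(ℝ, E) φ a.proj
  exact DFunLike.congr_fun (L.hasMFDerivAt (x := a.snd)).mfderiv v

lemma mvfderiv_fiberDerivative_section (hU : IsOpen U)
    (hφ : ContMDiffOn 𝓘(ℝ, E) 𝓘(ℝ, F) ∞ φ U) {Y : ∀ x : M, TangentSpace 𝓘(ℝ, E) x} {x : M}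
    (hx : x ∈ U)
    (hY : MDifferentiableAt 𝓘(ℝ, E) 𝓘(ℝ, E).tangent
      (fun y => (⟨y, Y y⟩ : TangentBundle 𝓘(ℝ, E) M)) x) (u : TangentSpace 𝓘(ℝ, E) x) :
    mvfderiv 𝓘(ℝ, E).tangent (fiberDerivative φ) (⟨x, Y x⟩ : TangentBundle 𝓘(ℝ, E) M)
      (mfderiv 𝓘(ℝ, E) 𝓘(ℝ, E).tangent (fun y => (⟨y, Y y⟩ : TangentBundle 𝓘(ℝ, E) M)) x u) =
      mvfderiv 𝓘(ℝ, E) (fun y => mvfderiv 𝓘(ℝ, E) φ y (Y y)) x u :=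
  mvfderiv_comp_mfderiv (K := 𝓘(ℝ, E)) (K' := 𝓘(ℝ, E).tangent)
    (f := fun y => (⟨y, Y y⟩ : TangentBundle 𝓘(ℝ, E) M)) x
    (mdifferentiableAt_fiberDerivative (a := ⟨x, Y x⟩) hU hφ hx) hY u

/-- The trivialization of the tangent bundle at `x₀` is the derivative of the chart at `x₀`. -/
lemma trivializationAt_eq_mvfderiv {x₀ x : M} (hx : x ∈ (chartAt E x₀).source)
    (v : TangentSpace 𝓘(ℝ, E) x) :
    (trivializationAt E (TangentSpace 𝓘(ℝ, E)) x₀ ⟨x, v⟩).2 =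
      mvfderiv 𝓘(ℝ, E) (extChartAt 𝓘(ℝ, E) x₀) x v := by
  have h := TangentBundle.continuousLinearMapAt_trivializationAt (I := 𝓘(ℝ, E)) (𝕜 := ℝ) hx
  have hx' : x ∈ (trivializationAt E (TangentSpace 𝓘(ℝ, E) : M → Type _) x₀).baseSet := hx
  exact (congrFun ((trivializationAt E (TangentSpace 𝓘(ℝ, E) : M → Type _)
    x₀).coe_linearMapAt_of_mem hx') v).symm.trans (DFunLike.congr_fun h v)

/-- The chart of `TM` at `a₀` is `(φ, dφ)`, where `φ` is the chart of `M` at `π(a₀)`; accordingly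
its derivative has two components. -/
lemma mvfderiv_extChartAt_tangent {a₀ a : TangentBundle 𝓘(ℝ, E) M}
    (ha : a.proj ∈ (chartAt E a₀.proj).source) (w : TangentSpace 𝓘(ℝ, E).tangent a) :
    mvfderiv 𝓘(ℝ, E).tangent (extChartAt 𝓘(ℝ, E).tangent a₀ : TangentBundle 𝓘(ℝ, E) M → E × E) a w =
      (mvfderiv 𝓘(ℝ, E) (extChartAt 𝓘(ℝ, E) a₀.proj) a.proj (dproj a w),
       mvfderiv 𝓘(ℝ, E).tangent (fiberDerivative (extChartAt 𝓘(ℝ, E) a₀.proj)) a w) := by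
  set φ : M → E := ↑(extChartAt 𝓘(ℝ, E) a₀.proj)
  have hφ : ContMDiffOn 𝓘(ℝ, E) 𝓘(ℝ, E) ∞ φ (chartAt E a₀.proj).source := contMDiffOn_extChartAt
  have hU : IsOpen (chartAt E a₀.proj).source := (chartAt E a₀.proj).open_source
  have hφa : MDifferentiableAt 𝓘(ℝ, E) 𝓘(ℝ, E) φ a.proj :=
    (hφ.contMDiffAt (hU.mem_nhds ha)).mdifferentiableAt (by simp)
  have hq : MDifferentiableAt 𝓘(ℝ, E).tangent 𝓘(ℝ, E)
    (fun b : TangentBundle 𝓘(ℝ, E) M => φ b.proj) a := hφa.comp a (mdifferentiableAt_proj a)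
  have hp := mdifferentiableAt_fiberDerivative hU hφ ha
  have h1 : (extChartAt 𝓘(ℝ, E).tangent a₀ : TangentBundle 𝓘(ℝ, E) M → E × E) =ᶠ[𝓝 a]
      fun b => (φ b.proj, fiberDerivative φ b) := by
    filter_upwards [(hU.preimage (FiberBundle.continuous_proj E _)).mem_nhds ha] with b hb
    have hb' : (extChartAt 𝓘(ℝ, E).tangent a₀ : TangentBundle 𝓘(ℝ, E) M → E × E) b =
        (φ b.proj, (trivializationAt E (TangentSpace 𝓘(ℝ, E)) a₀.proj b).2) := by
      rw [FiberBundle.extChartAt]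
      refine Prod.ext ?_ rfl
      change φ (trivializationAt E (TangentSpace 𝓘(ℝ, E) : M → Type _) a₀.proj b).1 = φ b.proj
      rw [Trivialization.coe_fst _ ((Trivialization.mem_source _).2 hb)]
    exact hb'.trans (Prod.ext rfl (trivializationAt_eq_mvfderiv hb b.snd))
  have h2 : HasMFDerivAt 𝓘(ℝ, E).tangent 𝓘(ℝ, E × E)
      (fun b : TangentBundle 𝓘(ℝ, E) M => (φ b.proj, fiberDerivative φ b)) a
      ((mvfderiv 𝓘(ℝ, E).tangent (fun b : TangentBundle 𝓘(ℝ, E) M => φ b.proj) a).prod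
        (mvfderiv 𝓘(ℝ, E).tangent (fiberDerivative φ) a)) :=
    ⟨hq.continuousAt.prodMk hp.continuousAt, hq.hasMFDerivAt.2.prodMk hp.hasMFDerivAt.2⟩
  rw [← mvfderiv_comp_proj a hφa]
  exact DFunLike.congr_fun (h2.congr_of_eventuallyEq h1).mfderiv w

/-- A vector field through a given tangent vector. -/
lemma exists_field_through (a : TangentBundle 𝓘(ℝ, E) M) :
    ∃ (x : M) (Y : ∀ x : M, TangentSpace 𝓘(ℝ, E) x),
      MDifferentiableAt 𝓘(ℝ, E) 𝓘(ℝ, E).tangent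
        (fun y => (⟨y, Y y⟩ : TangentBundle 𝓘(ℝ, E) M)) x ∧ a = ⟨x, Y x⟩ := by
  obtain ⟨x, v⟩ := a
  exact ⟨x, FiberBundle.extend E v, FiberBundle.mdifferentiableAt_extend 𝓘(ℝ, E) E v, by simp⟩

lemma mvfderiv_extChartAt_injective {x₀ x : M} (hx : x ∈ (chartAt E x₀).source) :
    Function.Injective (mvfderiv 𝓘(ℝ, E) (extChartAt 𝓘(ℝ, E) x₀) x) :=
  (isInvertible_mfderiv_extChartAt (I := 𝓘(ℝ, E)) (x := x₀) (y := x) (by simpa using hx)).injective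

lemma mvfderiv_extChartAt_surjective {x₀ x : M} (hx : x ∈ (chartAt E x₀).source) :
    Function.Surjective (mvfderiv 𝓘(ℝ, E) (extChartAt 𝓘(ℝ, E) x₀) x) :=
  (isInvertible_mfderiv_extChartAt (I := 𝓘(ℝ, E)) (x := x₀) (y := x) (by simpa using hx)).surjective

lemma eq_of_mvfderiv_eq {x₀ : M} {a : TangentBundle 𝓘(ℝ, E) M}
    (ha : a.proj ∈ (chartAt E x₀).source) {w w' : TangentSpace 𝓘(ℝ, E).tangent a}
    (h1 : dproj a w = dproj a w')
    (h2 : mvfderiv 𝓘(ℝ, E).tangent (fiberDerivative (extChartAt 𝓘(ℝ, E) x₀)) a w =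
      mvfderiv 𝓘(ℝ, E).tangent (fiberDerivative (extChartAt 𝓘(ℝ, E) x₀)) a w') : w = w' := by
  let a₀ : TangentBundle 𝓘(ℝ, E) M := ⟨x₀, 0⟩
  have hinj : Function.Injective (mvfderiv 𝓘(ℝ, E).tangent
      (extChartAt 𝓘(ℝ, E).tangent a₀ : TangentBundle 𝓘(ℝ, E) M → E × E) a) :=
    (isInvertible_mfderiv_extChartAt (I := 𝓘(ℝ, E).tangent) (x := a₀) (y := a) (by
      rw [extChartAt_source, TangentBundle.mem_chart_source_iff]; exact ha)).injective
  apply hinj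
  rw [mvfderiv_extChartAt_tangent (a₀ := a₀) ha, mvfderiv_extChartAt_tangent (a₀ := a₀) ha, h1, h2]

/-- Two vectors of `T_a(TM)` with the same projection to `M` differ by a vertical lift. -/
lemma exists_eq_add_verticalLift {a : TangentBundle 𝓘(ℝ, E) M}
    {w w' : TangentSpace 𝓘(ℝ, E).tangent a} (h : dproj a w = dproj a w') :
    ∃ v, w = w' + verticalLift a v := by
  have ha : a.proj ∈ (chartAt E a.proj).source := mem_chart_source E a.proj
  have hU : IsOpen (chartAt E a.proj).source := (chartAt E a.proj).open_source
  obtain ⟨v, hv⟩ := mvfderiv_extChartAt_surjective ha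
    (mvfderiv 𝓘(ℝ, E).tangent (fiberDerivative (extChartAt 𝓘(ℝ, E) a.proj)) a (w - w'))
  refine ⟨v, eq_of_mvfderiv_eq ha ?_ ?_⟩
  · rw [map_add, dproj_verticalLift, add_zero, h]
  · rw [map_add, mvfderiv_fiberDerivative_verticalLift hU contMDiffOn_extChartAt ha, hv, map_sub,
      add_sub_cancel]

lemma mvfderiv_flatConnection {x₀ x : M} (hx : x ∈ (chartAt E x₀).source)
    (Y : ∀ x : M, TangentSpace 𝓘(ℝ, E) x) (u : TangentSpace 𝓘(ℝ, E) x) :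
    mvfderiv 𝓘(ℝ, E) (extChartAt 𝓘(ℝ, E) x₀) x (flatConnection x₀ Y x u) =
      mvfderiv 𝓘(ℝ, E) (fun y => mvfderiv 𝓘(ℝ, E) (extChartAt 𝓘(ℝ, E) x₀) y (Y y)) x u := by
  rw [← trivializationAt_eq_mvfderiv hx, trivializationAt_flatConnection x₀ Y hx]
  refine DFunLike.congr_fun (mvfderiv_congr ?_) u
  filter_upwards [(chartAt E x₀).open_source.mem_nhds hx] with y hy
  exact trivializationAt_eq_mvfderiv hy (Y y)

lemma bijOn_verticalLift (a : TangentBundle 𝓘(ℝ, E) M) :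
    BijOn (verticalLift a) univ (verticalSpace a) := by
  have ha : a.proj ∈ (chartAt E a.proj).source := mem_chart_source E a.proj
  have hU := (chartAt E a.proj).open_source
  refine ⟨fun v _ => dproj_verticalLift a v, fun v _ v' _ h => ?_, fun w hw => ?_⟩
  · apply mvfderiv_extChartAt_injective ha
    rw [← mvfderiv_fiberDerivative_verticalLift hU contMDiffOn_extChartAt ha, h,
      mvfderiv_fiberDerivative_verticalLift hU contMDiffOn_extChartAt ha]
  · obtain ⟨v, hv⟩ := exists_eq_add_verticalLift (w := w) (w' := 0)
      ((show dproj a w = 0 from hw).trans (map_zero _).symm)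
    exact ⟨v, mem_univ _, (hv.trans (zero_add _)).symm⟩

lemma contMDiff_zeroSec :
    ContMDiff 𝓘(ℝ, E) 𝓘(ℝ, E).tangent ∞ (zeroSec : M → TangentBundle 𝓘(ℝ, E) M) :=
  contMDiff_zeroSection ℝ (TangentSpace 𝓘(ℝ, E) : M → Type _)

lemma dproj_mfderiv_zeroSec (x : M) (u : TangentSpace 𝓘(ℝ, E) x) :
    dproj (zeroSec x) (mfderiv 𝓘(ℝ, E) 𝓘(ℝ, E).tangent zeroSec x u) = u :=
  dproj_mfderiv_section (Y := 0) (contMDiff_zeroSec.mdifferentiable (by simp) x) u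

lemma contMDiff_tangentMap_proj :
    ContMDiff 𝓘(ℝ, E).tangent.tangent 𝓘(ℝ, E).tangent ∞
      (fun b : TangentBundle 𝓘(ℝ, E).tangent (TangentBundle 𝓘(ℝ, E) M) =>
        (⟨b.proj.proj, dproj b.proj b.snd⟩ : TangentBundle 𝓘(ℝ, E) M)) :=
  (contMDiff_proj (n := ∞) (TangentSpace 𝓘(ℝ, E) : M → Type _)).contMDiff_tangentMap (m := ∞)
    (by simp)

end TangentOfTangent

/-! ### The connector and the sum structure of a connection -/

section Connector

variable {E : Type*} [NormedAddCommGroup E] [NormedSpace ℝ E] [FiniteDimensional ℝ E]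
  {M : Type*} [TopologicalSpace M] [ChartedSpace E M] [IsManifold 𝓘(ℝ, E) ∞ M]
  (D : CovariantDerivative 𝓘(ℝ, E) E (TangentSpace 𝓘(ℝ, E) : M → Type _))

/-- The Christoffel tensor of a connection `D` in the chart at `x₀`: the difference of `D` and the
flat connection of the chart. The first argument is the vector that is differentiated. -/
def christoffel (x₀ x : M) :
    TangentSpace 𝓘(ℝ, E) x →L[ℝ] TangentSpace 𝓘(ℝ, E) x →L[ℝ] TangentSpace 𝓘(ℝ, E) x :=
  IsCovariantDerivativeOn.difference D.isCovariantDerivativeOn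
    (isCovariantDerivativeOn_flatConnection x₀) x

lemma christoffel_apply {x₀ x : M} (hx : x ∈ (chartAt E x₀).source)
    {Y : ∀ x : M, TangentSpace 𝓘(ℝ, E) x}
    (hY : MDifferentiableAt 𝓘(ℝ, E) 𝓘(ℝ, E).tangent
      (fun y => (⟨y, Y y⟩ : TangentBundle 𝓘(ℝ, E) M)) x) (u : TangentSpace 𝓘(ℝ, E) x) :
    christoffel D x₀ x (Y x) u = D Y x u - flatConnection x₀ Y x u :=
  DFunLike.congr_fun (IsCovariantDerivativeOn.difference_apply D.isCovariantDerivativeOn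
    (isCovariantDerivativeOn_flatConnection x₀) hx hY) u

/-- The connector of a connection: the linear map `T_a(TM) → T_{π(a)} M` that vanishes on the
horizontal space and inverts the vertical lift. Its expression in the chart at `π(a)` is taken as
the definition. -/
def connector (a : TangentBundle 𝓘(ℝ, E) M) :
    TangentSpace 𝓘(ℝ, E).tangent a →L[ℝ] TangentSpace 𝓘(ℝ, E) a.proj :=
  ((trivializationAt E (TangentSpace 𝓘(ℝ, E)) a.proj).symmL ℝ a.proj).comp
      (mvfderiv 𝓘(ℝ, E).tangent (fiberDerivative (extChartAt 𝓘(ℝ, E) a.proj)) a) +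
    (christoffel D a.proj a.proj a.snd).comp (dproj a)

lemma mvfderiv_connector_self (a : TangentBundle 𝓘(ℝ, E) M)
    (w : TangentSpace 𝓘(ℝ, E).tangent a) :
    mvfderiv 𝓘(ℝ, E) (extChartAt 𝓘(ℝ, E) a.proj) a.proj (connector D a w) =
      mvfderiv 𝓘(ℝ, E).tangent (fiberDerivative (extChartAt 𝓘(ℝ, E) a.proj)) a w +
      mvfderiv 𝓘(ℝ, E) (extChartAt 𝓘(ℝ, E) a.proj) a.proj
        (christoffel D a.proj a.proj a.snd (dproj a w)) := by
  have ha : a.proj ∈ (chartAt E a.proj).source := mem_chart_source E a.proj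
  set e := trivializationAt E (TangentSpace 𝓘(ℝ, E) : M → Type _) a.proj with he
  have ha' : a.proj ∈ e.baseSet := ha
  refine (map_add (mvfderiv 𝓘(ℝ, E) (extChartAt 𝓘(ℝ, E) a.proj) a.proj)
    (e.symmL ℝ a.proj (mvfderiv 𝓘(ℝ, E).tangent
      (fiberDerivative (extChartAt 𝓘(ℝ, E) a.proj)) a w)) _).trans ?_
  congr 1
  rw [← trivializationAt_eq_mvfderiv ha]
  simp [← he, ha']

lemma connector_verticalLift (a : TangentBundle 𝓘(ℝ, E) M) (v : TangentSpace 𝓘(ℝ, E) a.proj) :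
    connector D a (verticalLift a v) = v := by
  have ha : a.proj ∈ (chartAt E a.proj).source := mem_chart_source E a.proj
  apply mvfderiv_extChartAt_injective ha
  rw [mvfderiv_connector_self, dproj_verticalLift, map_zero, map_zero, add_zero,
    mvfderiv_fiberDerivative_verticalLift (chartAt E a.proj).open_source contMDiffOn_extChartAt ha]

lemma connector_mfderiv_section {Y : ∀ x : M, TangentSpace 𝓘(ℝ, E) x} {x : M}
    (hY : MDifferentiableAt 𝓘(ℝ, E) 𝓘(ℝ, E).tangent
      (fun y => (⟨y, Y y⟩ : TangentBundle 𝓘(ℝ, E) M)) x) (u : TangentSpace 𝓘(ℝ, E) x) :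
    connector D (⟨x, Y x⟩ : TangentBundle 𝓘(ℝ, E) M)
      (mfderiv 𝓘(ℝ, E) 𝓘(ℝ, E).tangent (fun y => (⟨y, Y y⟩ : TangentBundle 𝓘(ℝ, E) M)) x u) =
      D Y x u := by
  have hx : x ∈ (chartAt E x).source := mem_chart_source E x
  apply mvfderiv_extChartAt_injective hx
  have h1 := mvfderiv_connector_self D (⟨x, Y x⟩ : TangentBundle 𝓘(ℝ, E) M)
    (mfderiv 𝓘(ℝ, E) 𝓘(ℝ, E).tangent (fun y => (⟨y, Y y⟩ : TangentBundle 𝓘(ℝ, E) M)) x u)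
  rw [dproj_mfderiv_section hY, mvfderiv_fiberDerivative_section
    (chartAt E x).open_source contMDiffOn_extChartAt hx hY, christoffel_apply D hx hY, map_sub,
    mvfderiv_flatConnection hx] at h1
  exact h1.trans (add_sub_cancel _ _)

/-- The connector in the chart at an arbitrary point `x₀`; smoothness of the connector near `x₀`
can only be read off in a fixed chart. -/
lemma mvfderiv_connector {x₀ : M} {a : TangentBundle 𝓘(ℝ, E) M}
    (ha : a.proj ∈ (chartAt E x₀).source) (w : TangentSpace 𝓘(ℝ, E).tangent a) :
    mvfderiv 𝓘(ℝ, E) (extChartAt 𝓘(ℝ, E) x₀) a.proj (connector D a w) =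
      mvfderiv 𝓘(ℝ, E).tangent (fiberDerivative (extChartAt 𝓘(ℝ, E) x₀)) a w +
      mvfderiv 𝓘(ℝ, E) (extChartAt 𝓘(ℝ, E) x₀) a.proj
        (christoffel D x₀ a.proj a.snd (dproj a w)) := by
  obtain ⟨x, Y, hY, rfl⟩ := exists_field_through a
  have hx : x ∈ (chartAt E x₀).source := ha
  have hU := (chartAt E x₀).open_source
  obtain ⟨v, hv⟩ := exists_eq_add_verticalLift (dproj_mfderiv_section hY (dproj _ w)).symm
  have h1 : connector D (⟨x, Y x⟩ : TangentBundle 𝓘(ℝ, E) M) w = D Y x (dproj _ w) + v := by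
    conv_lhs => rw [hv]
    rw [map_add, connector_verticalLift, connector_mfderiv_section D hY]
  have h2 : mvfderiv 𝓘(ℝ, E).tangent (fiberDerivative (extChartAt 𝓘(ℝ, E) x₀))
      (⟨x, Y x⟩ : TangentBundle 𝓘(ℝ, E) M) w =
      mvfderiv 𝓘(ℝ, E) (fun y => mvfderiv 𝓘(ℝ, E) (extChartAt 𝓘(ℝ, E) x₀) y (Y y)) x (dproj _ w) +
        mvfderiv 𝓘(ℝ, E) (extChartAt 𝓘(ℝ, E) x₀) x v := by
    conv_lhs => rw [hv]
    rw [map_add, mvfderiv_fiberDerivative_section hU contMDiffOn_extChartAt hx hY,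
      mvfderiv_fiberDerivative_verticalLift hU contMDiffOn_extChartAt ha]
  rw [h1, h2, christoffel_apply D hx hY, map_sub, mvfderiv_flatConnection hx, map_add]
  abel

/-- Every vector of `T_a(TM)` is the sum of a velocity of a given field through `a` and a vertical
lift. -/
lemma eq_mfderiv_section_add_verticalLift {Y : ∀ x : M, TangentSpace 𝓘(ℝ, E) x} {x : M}
    (hY : MDifferentiableAt 𝓘(ℝ, E) 𝓘(ℝ, E).tangent
      (fun y => (⟨y, Y y⟩ : TangentBundle 𝓘(ℝ, E) M)) x)
    (w : TangentSpace 𝓘(ℝ, E).tangent (⟨x, Y x⟩ : TangentBundle 𝓘(ℝ, E) M)) :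
    w = mfderiv 𝓘(ℝ, E) 𝓘(ℝ, E).tangent (fun y => (⟨y, Y y⟩ : TangentBundle 𝓘(ℝ, E) M)) x
        (dproj _ w) + verticalLift _ (connector D _ w - D Y x (dproj _ w)) := by
  obtain ⟨v, hv⟩ := exists_eq_add_verticalLift (dproj_mfderiv_section hY (dproj _ w)).symm
  have h1 : connector D (⟨x, Y x⟩ : TangentBundle 𝓘(ℝ, E) M) w = D Y x (dproj _ w) + v := by
    conv_lhs => rw [hv]
    rw [map_add, connector_verticalLift, connector_mfderiv_section D hY]
  rw [h1, add_sub_cancel_left]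
  exact hv

/-- The projection and the connector together identify `T_a(TM)` with two copies of
`T_{π(a)} M`. -/
lemma bijective_dproj_prod_connector (a : TangentBundle 𝓘(ℝ, E) M) :
    Function.Bijective ((dproj a).prod (connector D a)) := by
  obtain ⟨x, Y, hY, rfl⟩ := exists_field_through a
  constructor
  · rw [injective_iff_map_eq_zero]
    intro w hw
    have h1 : dproj _ w = 0 := congrArg Prod.fst hw
    have h2 : connector D _ w = 0 := congrArg Prod.snd hw
    rw [eq_mfderiv_section_add_verticalLift D hY w, h1, h2]
    simp
  · rintro ⟨u, v⟩
    refine ⟨mfderiv 𝓘(ℝ, E) 𝓘(ℝ, E).tangent (fun y => (⟨y, Y y⟩ : TangentBundle 𝓘(ℝ, E) M)) x u +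
      verticalLift _ (v - D Y x u), Prod.ext ?_ ?_⟩
    · change dproj _ _ = u
      rw [map_add, dproj_verticalLift, dproj_mfderiv_section hY, add_zero]
    · change connector D _ _ = v
      rw [map_add, connector_verticalLift, connector_mfderiv_section D hY, add_sub_cancel]

lemma eq_of_dproj_eq_of_connector_eq {a : TangentBundle 𝓘(ℝ, E) M}
    {w w' : TangentSpace 𝓘(ℝ, E).tangent a} (h1 : dproj a w = dproj a w')
    (h2 : connector D a w = connector D a w') : w = w' :=
  (bijective_dproj_prod_connector D a).1 (Prod.ext h1 h2)

/-- The horizontal space is the kernel of the connector. -/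
lemma mem_horizontalSpace_iff {a : TangentBundle 𝓘(ℝ, E) M}
    {w : TangentSpace 𝓘(ℝ, E).tangent a} :
    w ∈ horizontalSpace D a ↔ connector D a w = 0 := by
  constructor
  · suffices horizontalSpace D a ≤ LinearMap.ker (connector D a).toLinearMap from fun h => this h
    refine Submodule.span_le.2 ?_
    rintro w ⟨Y, u, hY, h, rfl⟩
    obtain ⟨x, v⟩ := a
    have hv : Y x = v := by simpa using h
    subst hv
    change connector D _ (mfderiv 𝓘(ℝ, E) 𝓘(ℝ, E).tangent
      (fun y => (⟨y, Y y⟩ : TangentBundle 𝓘(ℝ, E) M)) x u - verticalLift _ (D Y x u)) = 0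
    rw [map_sub, connector_verticalLift, connector_mfderiv_section D hY, sub_self]
  · intro h
    obtain ⟨x, Y, hY, rfl⟩ := exists_field_through a
    refine Submodule.subset_span ⟨Y, dproj _ w, hY, rfl, ?_⟩
    have := eq_mfderiv_section_add_verticalLift D hY w
    rw [h, zero_sub, map_neg, ← sub_eq_add_neg] at this
    exact this

lemma mem_verticalSpace_iff {a : TangentBundle 𝓘(ℝ, E) M}
    {w : TangentSpace 𝓘(ℝ, E).tangent a} :
    w ∈ verticalSpace a ↔ w = verticalLift a (connector D a w) := by
  constructor
  · intro h
    refine eq_of_dproj_eq_of_connector_eq D ?_ ?_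
    · rw [dproj_verticalLift]
      exact h
    · rw [connector_verticalLift]
  · intro h
    rw [h]
    exact dproj_verticalLift _ _

lemma isCompl_horizontalSpace_verticalSpace (a : TangentBundle 𝓘(ℝ, E) M) :
    IsCompl (horizontalSpace D a) (verticalSpace a) := by
  rw [isCompl_iff, Submodule.disjoint_def, codisjoint_iff, Submodule.eq_top_iff']
  refine ⟨fun w h1 h2 => ?_, fun w => ?_⟩
  · rw [mem_horizontalSpace_iff] at h1
    rw [(mem_verticalSpace_iff D).1 h2, h1, map_zero]
  · rw [Submodule.mem_sup]
    refine ⟨w - verticalLift a (connector D a w), ?_, verticalLift a (connector D a w),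
      dproj_verticalLift _ _, sub_add_cancel _ _⟩
    rw [mem_horizontalSpace_iff, map_sub, connector_verticalLift, sub_self]

lemma bijOn_dproj (a : TangentBundle 𝓘(ℝ, E) M) :
    BijOn (dproj a) (horizontalSpace D a) univ := by
  refine ⟨fun _ _ => mem_univ _, fun w hw w' hw' h => ?_, fun u _ => ?_⟩
  · exact eq_of_dproj_eq_of_connector_eq D h
      (((mem_horizontalSpace_iff D).1 hw).trans ((mem_horizontalSpace_iff D).1 hw').symm)
  · obtain ⟨w, hw⟩ := (bijective_dproj_prod_connector D a).2 (u, 0)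
    exact ⟨w, (mem_horizontalSpace_iff D).2 (congrArg Prod.snd hw), congrArg Prod.fst hw⟩

/-- The zero section is a horizontal lift. -/
lemma connector_mfderiv_zeroSec (x : M) (u : TangentSpace 𝓘(ℝ, E) x) :
    connector D (zeroSec x) (mfderiv 𝓘(ℝ, E) 𝓘(ℝ, E).tangent zeroSec x u) = 0 := by
  have h := connector_mfderiv_section D (Y := 0)
    (contMDiff_zeroSec.mdifferentiable (by simp) x) u
  rw [D.zero] at h
  exact h

variable (J : AlmostComplexStructure 𝓘(ℝ, E) M)

/-- The splitting of `T_a(TM)` given by the projection and the connector. -/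
def splitting (a : TangentBundle 𝓘(ℝ, E) M) :
    TangentSpace 𝓘(ℝ, E).tangent a ≃L[ℝ]
      TangentSpace 𝓘(ℝ, E) a.proj × TangentSpace 𝓘(ℝ, E) a.proj :=
  (LinearEquiv.ofBijective _ (bijective_dproj_prod_connector D a)).toContinuousLinearEquiv

/-- The structure `J ⊕ J` on the tangent spaces of `TM`, for the splitting given by a connection
`D`. -/
def sumStructure (a : TangentBundle 𝓘(ℝ, E) M) :
    TangentSpace 𝓘(ℝ, E).tangent a →L[ℝ] TangentSpace 𝓘(ℝ, E).tangent a :=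
  ((splitting D a).symm : _ →L[ℝ] _).comp
    (((J.toFun a.proj).prodMap (J.toFun a.proj)).comp (splitting D a : _ →L[ℝ] _))

lemma splitting_sumStructure (a : TangentBundle 𝓘(ℝ, E) M) (w : TangentSpace 𝓘(ℝ, E).tangent a) :
    splitting D a (sumStructure D J a w) =
      (J.toFun a.proj (dproj a w), J.toFun a.proj (connector D a w)) :=
  (splitting D a).apply_symm_apply _

lemma dproj_sumStructure (a : TangentBundle 𝓘(ℝ, E) M) (w : TangentSpace 𝓘(ℝ, E).tangent a) :
    dproj a (sumStructure D J a w) = J.toFun a.proj (dproj a w) :=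
  congrArg Prod.fst (splitting_sumStructure D J a w)

lemma connector_sumStructure (a : TangentBundle 𝓘(ℝ, E) M) (w : TangentSpace 𝓘(ℝ, E).tangent a) :
    connector D a (sumStructure D J a w) = J.toFun a.proj (connector D a w) :=
  congrArg Prod.snd (splitting_sumStructure D J a w)

/-- The sum structure is the only one that is `J ⊕ J` for the splitting given by `D`. -/
lemma isSumStructure_iff
    (K : ∀ a : TangentBundle 𝓘(ℝ, E) M,
      TangentSpace 𝓘(ℝ, E).tangent a →L[ℝ] TangentSpace 𝓘(ℝ, E).tangent a) :
    IsSumStructure J D K ↔ K = sumStructure D J := by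
  constructor
  · intro h
    funext a
    ext1 w
    set v := verticalLift a (connector D a w) with hv
    have hw : w - v ∈ horizontalSpace D a := by
      rw [mem_horizontalSpace_iff, map_sub, hv, connector_verticalLift, sub_self]
    obtain ⟨h1, h2⟩ := (h a).1 _ hw
    rw [mem_horizontalSpace_iff] at h1
    have h3 : K a w = K a (w - v) + verticalLift a (J.toFun a.proj (connector D a w)) := by
      rw [← (h a).2, ← hv, ← map_add, sub_add_cancel]
    refine eq_of_dproj_eq_of_connector_eq D ?_ ?_
    · rw [dproj_sumStructure, h3, map_add, dproj_verticalLift, add_zero, h2, map_sub, hv,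
        dproj_verticalLift, sub_zero]
    · rw [connector_sumStructure, h3, map_add, h1, zero_add, connector_verticalLift]
  · rintro rfl a
    refine ⟨fun w hw => ⟨?_, dproj_sumStructure D J a w⟩, fun v => ?_⟩
    · rw [mem_horizontalSpace_iff] at hw ⊢
      rw [connector_sumStructure, hw, map_zero]
    · refine eq_of_dproj_eq_of_connector_eq D ?_ ?_
      · rw [dproj_sumStructure, dproj_verticalLift, dproj_verticalLift, map_zero]
      · rw [connector_sumStructure, connector_verticalLift, connector_verticalLift]

/-- Two minimal connections have the same sum structure. Their difference `A` is symmetric because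
the torsions agree, and `J`-linear in the argument that is differentiated because both connections
are almost complex; hence it is `J`-linear in the other argument too. -/
lemma sumStructure_eq {D D' : CovariantDerivative 𝓘(ℝ, E) E (TangentSpace 𝓘(ℝ, E) : M → Type _)}
    (hD : IsMinimalConnection J D) (hD' : IsMinimalConnection J D') :
    sumStructure D J = sumStructure D' J := by
  have : CompleteSpace E := FiniteDimensional.complete ℝ E
  have hA : ∀ {x : M} {Y : ∀ x : M, TangentSpace 𝓘(ℝ, E) x},
      MDifferentiableAt 𝓘(ℝ, E) 𝓘(ℝ, E).tangent
        (fun y => (⟨y, Y y⟩ : TangentBundle 𝓘(ℝ, E) M)) x → ∀ u : TangentSpace 𝓘(ℝ, E) x,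
      D.difference D' x (Y x) u = D Y x u - D' Y x u := fun {x Y} hY u =>
    DFunLike.congr_fun (IsCovariantDerivativeOn.difference_apply D.isCovariantDerivativeOnUniv
      D'.isCovariantDerivativeOnUniv (mem_univ _) hY) u
  have hJ : ∀ (x : M) (y u : TangentSpace 𝓘(ℝ, E) x),
      D.difference D' x (J.toFun x y) u = J.toFun x (D.difference D' x y u) := by
    intro x y u
    have hY := FiberBundle.mdifferentiableAt_extend 𝓘(ℝ, E) E y
    have h1 := hA (J.mdifferentiableAt_onField hY) u
    rw [hD.almostComplex _ x hY, hD'.almostComplex _ x hY, ← map_sub, ← hA hY] at h1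
    simpa [J.onField_apply] using h1
  have hsymm : ∀ (x : M) (y u : TangentSpace 𝓘(ℝ, E) x),
      D.difference D' x y u = D.difference D' x u y := by
    intro x y u
    have hY := FiberBundle.mdifferentiableAt_extend 𝓘(ℝ, E) E y
    have hX := FiberBundle.mdifferentiableAt_extend 𝓘(ℝ, E) E u
    have h1 := hA hY u
    have h2 := hA hX y
    have h3 := (hD.torsion_eq _ _ x hX hY).trans (hD'.torsion_eq _ _ x hX hY).symm
    rw [D.torsion_apply hX hY, D'.torsion_apply hX hY] at h3
    simp only [FiberBundle.extend_apply_self] at h1 h2 h3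
    rw [h1, h2]
    rw [sub_left_inj, sub_eq_sub_iff_add_eq_add] at h3
    rw [sub_eq_sub_iff_add_eq_add, h3, add_comm]
  have hP : ∀ (a : TangentBundle 𝓘(ℝ, E) M) (w : TangentSpace 𝓘(ℝ, E).tangent a),
      connector D a w = connector D' a w + D.difference D' a.proj a.snd (dproj a w) := by
    intro a w
    obtain ⟨x, Y, hY, rfl⟩ := exists_field_through a
    have h1 := congrArg (connector D _) (eq_mfderiv_section_add_verticalLift D' hY w)
    rw [map_add, connector_verticalLift, connector_mfderiv_section D hY] at h1
    rw [hA hY, h1]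
    abel
  funext a
  ext1 w
  refine eq_of_dproj_eq_of_connector_eq D ?_ ?_
  · rw [dproj_sumStructure, dproj_sumStructure]
  · rw [connector_sumStructure, hP, hP, connector_sumStructure, dproj_sumStructure, map_add, hsymm,
      hsymm _ _ (J.toFun _ _), hJ]

end Connector

/-! ### The almost complex structure of the tangent bundle -/

section Smoothness

variable {E : Type*} [NormedAddCommGroup E] [NormedSpace ℝ E] [FiniteDimensional ℝ E]
  {M : Type*} [TopologicalSpace M] [T2Space M] [ChartedSpace E M] [IsManifold 𝓘(ℝ, E) ∞ M]
  {D : CovariantDerivative 𝓘(ℝ, E) E (TangentSpace 𝓘(ℝ, E) : M → Type _)}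

lemma contMDiffOn_christoffel (hD : D.ContMDiffCovariantDerivative ∞) (x₀ : M) :
    ContMDiffOn 𝓘(ℝ, E) (𝓘(ℝ, E).prod 𝓘(ℝ, E →L[ℝ] E →L[ℝ] E)) ∞
      (fun x => (⟨x, christoffel D x₀ x⟩ : TotalSpace (E →L[ℝ] E →L[ℝ] E)
        (fun x : M => TangentSpace 𝓘(ℝ, E) x →L[ℝ] TangentSpace 𝓘(ℝ, E) x →L[ℝ]
          TangentSpace 𝓘(ℝ, E) x))) (chartAt E x₀).source := by
  intro x hx
  refine ContMDiffAt.contMDiffWithinAt ?_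
  refine contMDiffAt_hom_of_apply (F := E →L[ℝ] E)
    (V := fun x : M => TangentSpace 𝓘(ℝ, E) x →L[ℝ] TangentSpace 𝓘(ℝ, E) x) fun Y hY => ?_
  have hU := (chartAt E x₀).open_source
  have h1 := hD.contMDiff.contMDiff (σ := Y) (by simpa using hY.contMDiffOn)
  rw [contMDiffOn_univ] at h1
  have h2 := (contMDiffOn_flatConnection x₀ hY).contMDiffAt (hU.mem_nhds hx)
  refine ((h1 x).sub_section h2).congr_of_eventuallyEq ?_
  filter_upwards [hU.mem_nhds hx] with y hy
  congr 1
  ext u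
  exact christoffel_apply D hy (hY.mdifferentiable (by simp) y) u

lemma contMDiff_connector (hD : D.ContMDiffCovariantDerivative ∞) :
    ContMDiff 𝓘(ℝ, E).tangent.tangent 𝓘(ℝ, E).tangent ∞
      (fun b : TangentBundle 𝓘(ℝ, E).tangent (TangentBundle 𝓘(ℝ, E) M) =>
        (⟨b.proj.proj, connector D b.proj b.snd⟩ : TangentBundle 𝓘(ℝ, E) M)) := by
  intro b₀
  set x₀ : M := b₀.proj.proj
  set U := (chartAt E x₀).source
  have hU : IsOpen U := (chartAt E x₀).open_source
  have hx₀U : x₀ ∈ U := mem_chart_source E x₀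
  have hp : ContMDiff 𝓘(ℝ, E).tangent.tangent 𝓘(ℝ, E).tangent ∞
      (fun b : TangentBundle 𝓘(ℝ, E).tangent (TangentBundle 𝓘(ℝ, E) M) => b.proj) :=
    contMDiff_proj _
  have hpp : ContMDiff 𝓘(ℝ, E).tangent.tangent 𝓘(ℝ, E) ∞
      (fun b : TangentBundle 𝓘(ℝ, E).tangent (TangentBundle 𝓘(ℝ, E) M) => b.proj.proj) :=
    (contMDiff_proj _).comp hp
  have hdp : ContMDiff 𝓘(ℝ, E).tangent.tangent 𝓘(ℝ, E).tangent ∞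
      (fun b : TangentBundle 𝓘(ℝ, E).tangent (TangentBundle 𝓘(ℝ, E) M) =>
        (⟨b.proj.proj, dproj b.proj b.snd⟩ : TangentBundle 𝓘(ℝ, E) M)) :=
    contMDiff_tangentMap_proj
  have hΓ := (((contMDiffOn_christoffel hD x₀).contMDiffAt (hU.mem_nhds hx₀U)).comp b₀
    (hpp b₀)).clm_bundle_apply₂ (hp b₀) (hdp b₀)
  rw [contMDiffAt_totalSpace] at hΓ ⊢
  refine ⟨hpp b₀, ?_⟩
  have h1 := (contMDiffOn_mvfderiv (hU.preimage (FiberBundle.continuous_proj E _))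
    (contMDiffOn_mvfderiv hU (contMDiffOn_extChartAt (x := x₀)))).contMDiffAt (x := b₀)
    (((hU.preimage (FiberBundle.continuous_proj E _)).preimage
      (FiberBundle.continuous_proj (E × E) _)).mem_nhds hx₀U)
  refine (h1.add hΓ.2).congr_of_eventuallyEq ?_
  filter_upwards [hpp.continuous.continuousAt.preimage_mem_nhds (hU.mem_nhds hx₀U)] with b hb
  refine (trivializationAt_eq_mvfderiv hb _).trans ((mvfderiv_connector D hb b.snd).trans ?_)
  exact congrArg _ (trivializationAt_eq_mvfderiv hb _).symm

variable (J : AlmostComplexStructure 𝓘(ℝ, E) M)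

/-- In the chart of `TM` at `a₀` the two components of `J ⊕ J` are `J ∘ dπ` and
`J ∘ connector - Γ(a, J ∘ dπ)`, where `Γ` is the Christoffel tensor. -/
lemma contMDiff_sumStructure (hD : D.ContMDiffCovariantDerivative ∞) :
    ContMDiff 𝓘(ℝ, E).tangent.tangent 𝓘(ℝ, E).tangent.tangent ∞
      (fun b : TangentBundle 𝓘(ℝ, E).tangent (TangentBundle 𝓘(ℝ, E) M) =>
        (⟨b.proj, sumStructure D J b.proj b.snd⟩ :
          TangentBundle 𝓘(ℝ, E).tangent (TangentBundle 𝓘(ℝ, E) M))) := by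
  intro b₀
  set a₀ : TangentBundle 𝓘(ℝ, E) M := b₀.proj
  set x₀ : M := a₀.proj
  set U := (chartAt E x₀).source
  have hU : IsOpen U := (chartAt E x₀).open_source
  have hx₀U : x₀ ∈ U := mem_chart_source E x₀
  have hp : ContMDiff 𝓘(ℝ, E).tangent.tangent 𝓘(ℝ, E).tangent ∞
      (fun b : TangentBundle 𝓘(ℝ, E).tangent (TangentBundle 𝓘(ℝ, E) M) => b.proj) :=
    contMDiff_proj _
  have hpp : ContMDiff 𝓘(ℝ, E).tangent.tangent 𝓘(ℝ, E) ∞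
      (fun b : TangentBundle 𝓘(ℝ, E).tangent (TangentBundle 𝓘(ℝ, E) M) => b.proj.proj) :=
    (contMDiff_proj _).comp hp
  have hdp : ContMDiff 𝓘(ℝ, E).tangent.tangent 𝓘(ℝ, E).tangent ∞
      (fun b : TangentBundle 𝓘(ℝ, E).tangent (TangentBundle 𝓘(ℝ, E) M) =>
        (⟨b.proj.proj, dproj b.proj b.snd⟩ : TangentBundle 𝓘(ℝ, E) M)) :=
    contMDiff_tangentMap_proj
  have hJd := J.smooth.comp hdp
  have hJP := J.smooth.comp (contMDiff_connector hD)
  have hΓ := (((contMDiffOn_christoffel hD x₀).contMDiffAt (hU.mem_nhds hx₀U)).comp b₀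
    (hpp b₀)).clm_bundle_apply₂ (hp b₀) (hJd b₀)
  have h1 := hJd b₀
  have h2 := hJP b₀
  rw [contMDiffAt_totalSpace] at hΓ h1 h2 ⊢
  refine ⟨hp b₀, ?_⟩
  refine (h1.2.prodMk_space (h2.2.sub hΓ.2)).congr_of_eventuallyEq ?_
  filter_upwards [hpp.continuous.continuousAt.preimage_mem_nhds (hU.mem_nhds hx₀U)] with b hb
  have hb' : b.proj ∈ (chartAt (ModelProd E E) a₀).source := by
    rw [TangentBundle.mem_chart_source_iff]
    exact hb
  have hτ := TangentBundle.continuousLinearMapAt_trivializationAt (I := 𝓘(ℝ, E).tangent)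
    (𝕜 := ℝ) hb'
  have hb'' : b.proj ∈ (trivializationAt (E × E) (TangentSpace 𝓘(ℝ, E).tangent :
    TangentBundle 𝓘(ℝ, E) M → Type _) a₀).baseSet := hb'
  refine (congrFun ((trivializationAt (E × E) (TangentSpace 𝓘(ℝ, E).tangent :
    TangentBundle 𝓘(ℝ, E) M → Type _) a₀).coe_linearMapAt_of_mem hb'') _).symm.trans
    ((DFunLike.congr_fun hτ (sumStructure D J b.proj b.snd)).trans ?_)
  refine (mvfderiv_extChartAt_tangent (a₀ := a₀) hb _).trans (Prod.ext ?_ ?_)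
  · rw [dproj_sumStructure]
    exact (trivializationAt_eq_mvfderiv hb _).symm
  · have h3 := eq_sub_of_add_eq (mvfderiv_connector D hb (sumStructure D J b.proj b.snd)).symm
    rw [dproj_sumStructure, connector_sumStructure] at h3
    refine h3.trans ?_
    exact congrArg₂ _ (trivializationAt_eq_mvfderiv hb _).symm
      (trivializationAt_eq_mvfderiv hb _).symm

/-- The almost complex structure `J ⊕ J` on `TM` given by a smooth connection. -/
def sumAlmostComplexStructure (hD : D.ContMDiffCovariantDerivative ∞) :
    AlmostComplexStructure 𝓘(ℝ, E).tangent (TangentBundle 𝓘(ℝ, E) M) where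
  toFun := sumStructure D J
  sq_eq_neg a w := by
    refine eq_of_dproj_eq_of_connector_eq D ?_ ?_
    · rw [dproj_sumStructure, dproj_sumStructure, J.sq_eq_neg, map_neg]
    · rw [connector_sumStructure, connector_sumStructure, J.sq_eq_neg, map_neg]
  smooth := contMDiff_sumStructure J hD

/-- The projection is pseudoholomorphic: this is the `dπ`-component of `J ⊕ J`. -/
lemma pseudoholomorphic_proj (hD : D.ContMDiffCovariantDerivative ∞) :
    Pseudoholomorphic (sumAlmostComplexStructure J hD) J
      (proj : TangentBundle 𝓘(ℝ, E) M → M) :=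
  ⟨contMDiff_proj _, fun a w => dproj_sumStructure D J a w⟩

/-- The zero section is pseudoholomorphic, because it is horizontal. -/
lemma pseudoholomorphic_zeroSec (hD : D.ContMDiffCovariantDerivative ∞) :
    Pseudoholomorphic J (sumAlmostComplexStructure J hD)
      (zeroSec : M → TangentBundle 𝓘(ℝ, E) M) := by
  refine ⟨contMDiff_zeroSec, fun x u => ?_⟩
  refine eq_of_dproj_eq_of_connector_eq D ?_ ?_
  · refine (dproj_mfderiv_zeroSec x _).trans ?_
    refine Eq.trans ?_ (dproj_sumStructure D J (zeroSec x) _).symm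
    rw [dproj_mfderiv_zeroSec]
    rfl
  · refine (connector_mfderiv_zeroSec D x _).trans ?_
    refine Eq.trans ?_ (connector_sumStructure D J (zeroSec x) _).symm
    rw [connector_mfderiv_zeroSec, map_zero]

end Smoothness

/-! ### Complex coordinates -/

section Coordinates

variable {E : Type*} [NormedAddCommGroup E] [NormedSpace ℝ E]
  {H : Type*} [TopologicalSpace H] {I : ModelWithCorners ℝ E H}
  {N : Type*} [TopologicalSpace N] [ChartedSpace H N] [IsManifold I ∞ N]

/-- Complex coordinates of an integrable structure, as vector-valued functions on `N`. -/
lemma AlmostComplexStructure.Integrable.exists_coordinates {J : AlmostComplexStructure I N}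
    (hJ : J.Integrable) (p : N) :
    ∃ (n : ℕ) (φ : N → Fin n → ℂ) (U : Set N), IsOpen U ∧ p ∈ U ∧
      ContMDiffOn I 𝓘(ℝ, Fin n → ℂ) ∞ φ U ∧
      (∀ x ∈ U, Function.Bijective (mvfderiv I φ x)) ∧
      ∀ x ∈ U, ∀ v : TangentSpace I x,
        mvfderiv I φ x (J.toFun x v) = Complex.I • mvfderiv I φ x v := by
  obtain ⟨n, φ, hp, hs, hs', h⟩ := hJ p
  refine ⟨n, φ, φ.source, φ.open_source, hp, hs, fun x hx => ?_, h⟩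
  have hφ : φ.MDifferentiable I 𝓘(ℝ, Fin n → ℂ) :=
    ⟨hs.mdifferentiableOn (by simp), hs'.mdifferentiableOn (by simp)⟩
  exact hφ.mfderiv_bijective hx

end Coordinates

section InverseFunction

variable {E : Type*} [NormedAddCommGroup E] [NormedSpace ℝ E] [FiniteDimensional ℝ E]
  {H : Type*} [TopologicalSpace H] {I : ModelWithCorners ℝ E H} [I.Boundaryless]
  {N : Type*} [TopologicalSpace N] [ChartedSpace H N] [IsManifold I ∞ N]

/-- The inverse function theorem for a smooth map from a manifold to a vector space. -/
theorem exists_openPartialHomeomorph_of_bijective_mvfderiv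
    {F : Type*} [NormedAddCommGroup F] [NormedSpace ℝ F] [FiniteDimensional ℝ F]
    {ψ : N → F} {V : Set N} (hV : IsOpen V) (hψ : ContMDiffOn I 𝓘(ℝ, F) ∞ ψ V) {p : N} (hp : p ∈ V)
    (hd : Function.Bijective (mvfderiv I ψ p)) :
    ∃ Φ : OpenPartialHomeomorph N F, p ∈ Φ.source ∧ Φ.source ⊆ V ∧ EqOn Φ ψ Φ.source ∧
      ContMDiffOn I 𝓘(ℝ, F) ∞ Φ Φ.source ∧ ContMDiffOn 𝓘(ℝ, F) I ∞ Φ.symm Φ.target := by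
  have : CompleteSpace E := FiniteDimensional.complete ℝ E
  set c := extChartAt I p
  let κ : OpenPartialHomeomorph N E := (chartAt H p).transHomeomorph I.toHomeomorph
  have hκsource : κ.source = c.source := (extChartAt_source I p).symm
  have hpc : p ∈ c.source := mem_extChartAt_source p
  -- the map in the chart
  set h : E → F := fun y => ψ (c.symm y)
  set S : Set E := c.target ∩ c.symm ⁻¹' V
  have hSo : IsOpen S :=
    (continuousOn_extChartAt_symm p).isOpen_inter_preimage (isOpen_extChartAt_target p) hV
  have hpS : c p ∈ S := ⟨c.map_source hpc, by
    rw [mem_preimage, c.left_inv hpc]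
    exact hp⟩
  have hcs : ContMDiffOn 𝓘(ℝ, E) I ∞ c.symm c.target := contMDiffOn_extChartAt_symm p
  have hsm : ContDiffOn ℝ ∞ h S :=
    (hψ.comp (hcs.mono inter_subset_left) fun y hy => hy.2).contDiffOn
  have hcd : ∀ y, y ∈ S → ContDiffAt ℝ ∞ h y := fun y hy => hsm.contDiffAt (hSo.mem_nhds hy)
  have hbij : Function.Bijective (fderiv ℝ h (c p)) := by
    have h1 := isInvertible_mfderivWithin_extChartAt_symm (I := I) (x := p) (mem_extChartAt_target p)
    rw [I.range_eq_univ, mfderivWithin_univ] at h1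
    have h2 : MDifferentiableAt 𝓘(ℝ, E) I c.symm (c p) :=
      (hcs.contMDiffAt ((isOpen_extChartAt_target p).mem_nhds hpS.1)).mdifferentiableAt (by simp)
    have hcp : c.symm (c p) = p := c.left_inv hpc
    have h3 : MDifferentiableAt I 𝓘(ℝ, F) ψ (c.symm (c p)) := by
      rw [hcp]
      exact (hψ.contMDiffAt (hV.mem_nhds hp)).mdifferentiableAt (by simp)
    have h4 : ∀ v, fderiv ℝ h (c p) v =
        mvfderiv I ψ (c.symm (c p)) (mfderiv 𝓘(ℝ, E) I c.symm (c p) v) := fun v => by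
      rw [mvfderiv_comp_mfderiv (K := 𝓘(ℝ, E)) (c p) h3 h2 v]
      exact (DFunLike.congr_fun (mfderiv_eq_fderiv (f := h) (x := c p)) v).symm
    have h5 : Function.Bijective (mvfderiv I ψ (c.symm (c p))) := by rw [hcp]; exact hd
    have h6 : ⇑(fderiv ℝ h (c p)) = ⇑(mvfderiv I ψ (c.symm (c p))) ∘
      ⇑(mfderiv 𝓘(ℝ, E) I c.symm (c p)) := funext h4
    rw [h6]
    exact h5.comp h1.bijective
  let L : E ≃L[ℝ] F :=
    (LinearEquiv.ofBijective (fderiv ℝ h (c p)).toLinearMap hbij).toContinuousLinearEquiv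
  have hL : HasFDerivAt h (L : E →L[ℝ] F) (c p) := by
    have : (L : E →L[ℝ] F) = fderiv ℝ h (c p) := by ext v; rfl
    rw [this]
    exact ((hcd _ hpS).differentiableAt (by simp)).hasFDerivAt
  let h' := (hcd _ hpS).toOpenPartialHomeomorph h hL (by simp)
  -- the set of points where the derivative stays invertible
  set S' : Set E := S ∩ fderiv ℝ h ⁻¹' range ((↑) : (E ≃L[ℝ] F) → E →L[ℝ] F)
  have hS'o : IsOpen S' := (hsm.continuousOn_fderiv_of_isOpen hSo (by simp)).isOpen_inter_preimage
    hSo ContinuousLinearEquiv.isOpen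
  let Φ := κ.trans (h'.restrOpen S' hS'o)
  have hΦ : ∀ x, Φ x = ψ (c.symm (c x)) := fun x => rfl
  have hsub : ∀ x ∈ Φ.source, x ∈ c.source ∧ c x ∈ S' := by
    intro x hx
    have h1 : x ∈ κ.source ∩ κ ⁻¹' (h'.source ∩ S') := hx
    exact ⟨hκsource ▸ h1.1, h1.2.2⟩
  have hsubV : Φ.source ⊆ V := by
    intro x hx
    have h1 := (hsub x hx).2.1.2
    rw [mem_preimage, c.left_inv (hsub x hx).1] at h1
    exact h1
  have hEq : EqOn Φ ψ Φ.source := fun x hx => by rw [hΦ, c.left_inv (hsub x hx).1]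
  refine ⟨Φ, ?_, hsubV, hEq, (hψ.mono hsubV).congr hEq, ?_⟩
  · have h1 : p ∈ κ.source ∩ κ ⁻¹' (h'.source ∩ S') := by
      refine ⟨hκsource ▸ hpc, ?_, hpS, L, hL.fderiv.symm⟩
      exact (hcd _ hpS).mem_toOpenPartialHomeomorph_source hL (by simp)
    exact h1
  · intro y hy
    have h1 : y ∈ (h'.restrOpen S' hS'o).target ∩ (h'.restrOpen S' hS'o).symm ⁻¹' κ.target := hy
    have h2 : (h'.restrOpen S' hS'o).symm y ∈ (h'.restrOpen S' hS'o).source :=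
      (h'.restrOpen S' hS'o).map_target h1.1
    have h3 : h'.symm y ∈ h'.source ∩ S' := h2
    have h4 : y ∈ h'.target := by
      have := (h'.restrOpen S' hS'o).right_inv h1.1
      rw [← this]
      exact h'.map_source h3.1
    obtain ⟨A, hA⟩ := h3.2.2
    have h5 : ContDiffAt ℝ ∞ h'.symm y := by
      refine h'.contDiffAt_symm h4 (f₀' := A) ?_ (hcd _ h3.2.1)
      rw [hA]
      exact ((hcd _ h3.2.1).differentiableAt (by simp)).hasFDerivAt
    have h6 : ContMDiffAt 𝓘(ℝ, E) I ∞ c.symm (h'.symm y) :=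
      hcs.contMDiffAt ((isOpen_extChartAt_target p).mem_nhds h3.2.1.1)
    exact (h6.comp y h5.contMDiffAt).contMDiffWithinAt

/-- A criterion for integrability: it suffices to find, near every point, a smooth immersion into
a complex vector space whose differential is complex linear. Composing it with a complex linear
projection onto the image of the differential at the point gives holomorphic coordinates. -/
theorem AlmostComplexStructure.integrable_of_immersion (J : AlmostComplexStructure I N)
    (h : ∀ p : N, ∃ (n : ℕ) (ψ : N → Fin n → ℂ) (V : Set N), IsOpen V ∧ p ∈ V ∧
      ContMDiffOn I 𝓘(ℝ, Fin n → ℂ) ∞ ψ V ∧ Function.Injective (mvfderiv I ψ p) ∧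
      ∀ x ∈ V, ∀ v : TangentSpace I x,
        mvfderiv I ψ x (J.toFun x v) = Complex.I • mvfderiv I ψ x v) :
    J.Integrable := by
  intro p
  obtain ⟨n, ψ, V, hV, hp, hψ, hinj, hJ⟩ := h p
  let W : Submodule ℂ (Fin n → ℂ) :=
    { carrier := range (mvfderiv I ψ p)
      add_mem' := by
        rintro _ _ ⟨v, rfl⟩ ⟨w, rfl⟩
        exact ⟨v + w, map_add _ _ _⟩
      zero_mem' := ⟨0, map_zero _⟩
      smul_mem' := by
        rintro z _ ⟨v, rfl⟩
        refine ⟨z.re • v + z.im • J.toFun p v, ?_⟩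
        rw [map_add, map_smul, map_smul, hJ p hp]
        ext i
        simp only [Pi.add_apply, Pi.smul_apply, Complex.real_smul, smul_eq_mul]
        conv_rhs => rw [← Complex.re_add_im z]
        ring }
  obtain ⟨P, hP⟩ := LinearMap.exists_leftInverse_of_injective W.subtype W.ker_subtype
  let b := Module.finBasis ℂ W
  let Q : (Fin n → ℂ) →L[ℂ] (Fin (Module.finrank ℂ W) → ℂ) :=
    LinearMap.toContinuousLinearMap (b.equivFun.toLinearMap ∘ₗ P)
  have hQW : ∀ w : W, Q w = b.equivFun w := fun w =>
    congrArg b.equivFun (DFunLike.congr_fun hP w)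
  let Qr : (Fin n → ℂ) →L[ℝ] (Fin (Module.finrank ℂ W) → ℂ) := Q.restrictScalars ℝ
  have hd : ∀ x ∈ V, ∀ v : TangentSpace I x,
      mvfderiv I (fun y => Q (ψ y)) x v = Q (mvfderiv I ψ x v) := by
    intro x hx v
    have h1 := (hψ.contMDiffAt (hV.mem_nhds hx)).mdifferentiableAt (by simp)
    have h2 := (Qr.hasMFDerivAt (x := ψ x)).comp x h1.hasMFDerivAt
    exact DFunLike.congr_fun h2.mfderiv v
  have hψ' : ContMDiffOn I 𝓘(ℝ, Fin (Module.finrank ℂ W) → ℂ) ∞ (fun y => Q (ψ y)) V :=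
    Qr.contMDiff.comp_contMDiffOn hψ
  have hbij : Function.Bijective (mvfderiv I (fun y => Q (ψ y)) p) := by
    have hf : ∀ v, mvfderiv I (fun y => Q (ψ y)) p v =
        b.equivFun (⟨mvfderiv I ψ p v, v, rfl⟩ : W) := fun v => by
      rw [hd p hp v]
      exact hQW ⟨mvfderiv I ψ p v, v, rfl⟩
    constructor
    · intro v v' hv
      rw [hf, hf] at hv
      exact hinj (congrArg Subtype.val (b.equivFun.injective hv))
    · intro y
      obtain ⟨v, hv⟩ := (b.equivFun.symm y).2
      refine ⟨v, ?_⟩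
      rw [hf, ← b.equivFun.apply_symm_apply y]
      exact congrArg _ (Subtype.ext hv)
  obtain ⟨Φ, hpΦ, hΦV, hΦ, hs, hs'⟩ :=
    exists_openPartialHomeomorph_of_bijective_mvfderiv hV hψ' hp hbij
  refine ⟨_, Φ, hpΦ, hs, hs', fun x hx v => ?_⟩
  have h1 : (Φ : N → _) =ᶠ[𝓝 x] fun y => Q (ψ y) := by
    filter_upwards [Φ.open_source.mem_nhds hx] with y hy using hΦ hy
  have h2 := mvfderiv_congr (I := I) h1
  have h3 : mvfderiv I Φ x (J.toFun x v) = Complex.I • mvfderiv I Φ x v := by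
    rw [h2, hd x (hΦV hx), hd x (hΦV hx), hJ x (hΦV hx), map_smul]
  exact h3

end InverseFunction

/-! ### Integrability of the structure on the tangent bundle -/

section Integrability

variable {E : Type*} [NormedAddCommGroup E] [NormedSpace ℝ E]
  {M : Type*} [TopologicalSpace M] [ChartedSpace E M]

section CoordinateField

variable {F : Type*} [NormedAddCommGroup F] [NormedSpace ℝ F]
  {φ : M → F} {U : Set M}

/-- The vector field that is constant, equal to `c`, in the coordinates `φ`. It has the junk value
zero where the derivative of `φ` is not invertible. -/
def coordinateField (φ : M → F) (c : F) : ∀ x : M, TangentSpace 𝓘(ℝ, E) x :=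
  mpullback 𝓘(ℝ, E) 𝓘(ℝ, F) φ (fun _ => c)

lemma isInvertible_mfderiv [FiniteDimensional ℝ E] {x : M} (hd : Function.Bijective (mvfderiv 𝓘(ℝ, E) φ x)) :
    (mfderiv 𝓘(ℝ, E) 𝓘(ℝ, F) φ x).IsInvertible := by
  let L : TangentSpace 𝓘(ℝ, E) x ≃L[ℝ] F :=
    (LinearEquiv.ofBijective (mvfderiv 𝓘(ℝ, E) φ x).toLinearMap hd).toContinuousLinearEquiv
  exact ⟨L, by ext v; rfl⟩

lemma mvfderiv_coordinateField [FiniteDimensional ℝ E] {x : M} (hd : Function.Bijective (mvfderiv 𝓘(ℝ, E) φ x)) (c : F) :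
    mvfderiv 𝓘(ℝ, E) φ x (coordinateField φ c x) = c :=
  (isInvertible_mfderiv hd).self_apply_inverse c

lemma contMDiff_const_vectorField (c : F) :
    ContMDiff 𝓘(ℝ, F) 𝓘(ℝ, F).tangent ∞ (fun y : F => (⟨y, c⟩ : TangentBundle 𝓘(ℝ, F) F)) := by
  intro y
  exact contMDiffAt_vectorSpace_iff_contDiffAt.2 contDiffAt_const

variable [FiniteDimensional ℝ E] [IsManifold 𝓘(ℝ, E) ∞ M]

lemma mdifferentiableAt_coordinateField (hU : IsOpen U)
    (hφ : ContMDiffOn 𝓘(ℝ, E) 𝓘(ℝ, F) ∞ φ U) {x : M} (hx : x ∈ U)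
    (hd : Function.Bijective (mvfderiv 𝓘(ℝ, E) φ x)) (c : F) :
    MDifferentiableAt 𝓘(ℝ, E) 𝓘(ℝ, E).tangent
      (fun y => (⟨y, coordinateField φ c y⟩ : TangentBundle 𝓘(ℝ, E) M)) x := by
  have : CompleteSpace E := FiniteDimensional.complete ℝ E
  exact MDifferentiableAt.mpullback_vectorField (I' := 𝓘(ℝ, F)) (V := fun _ => c)
    ((contMDiff_const_vectorField c).mdifferentiable (by simp) _)
    (hφ.contMDiffAt (hU.mem_nhds hx)) (isInvertible_mfderiv hd) (ENat.LEInfty.out)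

/-- Coordinate fields commute. -/
lemma mlieBracket_coordinateField [FiniteDimensional ℝ F] (hU : IsOpen U)
    (hφ : ContMDiffOn 𝓘(ℝ, E) 𝓘(ℝ, F) ∞ φ U) {x : M} (hx : x ∈ U) (c c' : F) :
    mlieBracket 𝓘(ℝ, E) (coordinateField φ c) (coordinateField φ c') x = 0 := by
  have : CompleteSpace E := FiniteDimensional.complete ℝ E
  have : CompleteSpace F := FiniteDimensional.complete ℝ F
  have : IsManifold 𝓘(ℝ, E) (minSmoothness ℝ 2) M := by
    rw [minSmoothness_of_isRCLikeNormedField]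
    infer_instance
  have h := mpullback_mlieBracket (I := 𝓘(ℝ, E)) (I' := 𝓘(ℝ, F)) (f := φ) (V := fun _ => c)
    (W := fun _ => c') (x₀ := x) (n := ∞)
    ((contMDiff_const_vectorField c).mdifferentiable (by simp) _)
    ((contMDiff_const_vectorField c').mdifferentiable (by simp) _)
    (hφ.contMDiffAt (hU.mem_nhds hx)) (by
      rw [minSmoothness_of_isRCLikeNormedField]
      exact ENat.LEInfty.out)
  refine h.symm.trans ?_
  have h0 : lieBracketWithin ℝ (fun _ : F => c) (fun _ => c') univ (φ x) = 0 := by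
    simp [lieBracketWithin]
  have h1 : mlieBracketWithin 𝓘(ℝ, F) (fun y : F => (c : TangentSpace 𝓘(ℝ, F) y))
      (fun y => (c' : TangentSpace 𝓘(ℝ, F) y)) univ (φ x) = 0 :=
    (congrFun mlieBracketWithin_eq_lieBracketWithin (φ x)).trans h0
  exact (congrArg (mfderiv 𝓘(ℝ, E) 𝓘(ℝ, F) φ x).inverse h1).trans (map_zero _)

end CoordinateField

variable [FiniteDimensional ℝ E] [IsManifold 𝓘(ℝ, E) ∞ M]

/-- In holomorphic coordinates, the derivative of a coordinate field with respect to a minimal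
connection is complex linear: the Nijenhuis tensor, and with it the torsion, vanishes, so that
`∇_X Y = ∇_Y X` for commuting fields, and the right-hand side is complex linear in `X`. -/
lemma IsMinimalConnection.coordinateField_apply {J : AlmostComplexStructure 𝓘(ℝ, E) M}
    {D : CovariantDerivative 𝓘(ℝ, E) E (TangentSpace 𝓘(ℝ, E) : M → Type _)}
    (hD : IsMinimalConnection J D) {n : ℕ} {φ : M → Fin n → ℂ} {U : Set M} (hU : IsOpen U)
    (hφ : ContMDiffOn 𝓘(ℝ, E) 𝓘(ℝ, Fin n → ℂ) ∞ φ U)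
    (hd : ∀ x ∈ U, Function.Bijective (mvfderiv 𝓘(ℝ, E) φ x))
    (hJ : ∀ x ∈ U, ∀ v : TangentSpace 𝓘(ℝ, E) x,
      mvfderiv 𝓘(ℝ, E) φ x (J.toFun x v) = Complex.I • mvfderiv 𝓘(ℝ, E) φ x v)
    {x : M} (hx : x ∈ U) (c : Fin n → ℂ) (u : TangentSpace 𝓘(ℝ, E) x) :
    D (coordinateField φ c) x (J.toFun x u) = J.toFun x (D (coordinateField φ c) x u) := by
  have : CompleteSpace E := FiniteDimensional.complete ℝ E
  have hJc : ∀ c : Fin n → ℂ,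
      J.onField (coordinateField φ c) =ᶠ[𝓝 x] coordinateField φ (Complex.I • c) := by
    intro c
    filter_upwards [hU.mem_nhds hx] with y hy
    apply (hd y hy).1
    rw [J.onField_apply, hJ y hy, mvfderiv_coordinateField (hd y hy),
      mvfderiv_coordinateField (hd y hy)]
  have hbr : ∀ c c' : Fin n → ℂ,
      mlieBracket 𝓘(ℝ, E) (coordinateField φ c) (coordinateField φ c') x = 0 :=
    fun c c' => mlieBracket_coordinateField hU hφ hx c c'
  have hm : ∀ c : Fin n → ℂ, MDifferentiableAt 𝓘(ℝ, E) 𝓘(ℝ, E).tangent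
      (fun y => (⟨y, coordinateField φ c y⟩ : TangentBundle 𝓘(ℝ, E) M)) x :=
    fun c => mdifferentiableAt_coordinateField hU hφ hx (hd x hx) c
  have hbr' : ∀ c c' : Fin n → ℂ,
      mlieBracket 𝓘(ℝ, E) (J.onField (coordinateField φ c)) (coordinateField φ c') x = 0 :=
    fun c c' => ((hJc c).mlieBracket_vectorField_eq EventuallyEq.rfl).trans (hbr _ _)
  have hbr'' : ∀ c c' : Fin n → ℂ,
      mlieBracket 𝓘(ℝ, E) (coordinateField φ c) (J.onField (coordinateField φ c')) x = 0 :=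
    fun c c' => (EventuallyEq.rfl.mlieBracket_vectorField_eq (hJc c')).trans (hbr _ _)
  have hN : ∀ c c' : Fin n → ℂ,
      J.nijenhuis (coordinateField φ c) (coordinateField φ c') x = 0 := by
    intro c c'
    have h1 : mlieBracket 𝓘(ℝ, E) (J.onField (coordinateField φ c))
        (J.onField (coordinateField φ c')) x = 0 :=
      ((hJc c).mlieBracket_vectorField_eq (hJc c')).trans (hbr _ _)
    simp [AlmostComplexStructure.nijenhuis, h1, hbr, hbr', hbr'']
  have hT : ∀ c c' : Fin n → ℂ,
      D.torsion x (coordinateField φ c x) (coordinateField φ c' x) = 0 := by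
    intro c c'
    rw [hD.torsion_eq _ _ x (hm c) (hm c'), hN, smul_zero]
  -- `X` and `JX` are the coordinate fields through `u` and `Ju`
  obtain ⟨d, hdu⟩ : ∃ d, coordinateField φ d x = u :=
    ⟨_, (hd x hx).1 (mvfderiv_coordinateField (hd x hx) (mvfderiv 𝓘(ℝ, E) φ x u))⟩
  have hsymm : D (coordinateField φ c) x u = D (coordinateField φ d) x (coordinateField φ c x) := by
    have h := D.torsion_apply (hm d) (hm c)
    rw [hT, hbr, sub_zero, hdu] at h
    exact (sub_eq_zero.1 h.symm)
  have hsymmJ : D (coordinateField φ c) x (J.toFun x u) =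
      D (J.onField (coordinateField φ d)) x (coordinateField φ c x) := by
    have h := D.torsion_apply (J.mdifferentiableAt_onField (hm d)) (hm c)
    have h0 : D.torsion x (J.onField (coordinateField φ d) x) (coordinateField φ c x) = 0 := by
      rw [(hJc d).self_of_nhds]
      exact hT _ _
    rw [h0, hbr', sub_zero, J.onField_apply, hdu] at h
    exact (sub_eq_zero.1 h.symm)
  rw [hsymmJ, hsymm]
  exact hD.almostComplex _ _ (hm _) _

variable (J : AlmostComplexStructure 𝓘(ℝ, E) M)
  {D : CovariantDerivative 𝓘(ℝ, E) E (TangentSpace 𝓘(ℝ, E) : M → Type _)}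

/-- The derivative `dφ` of holomorphic coordinates, as a function on `TM`, is holomorphic. At a
vertical lift this is the complex linearity of `dφ`; at the velocities of the coordinate field
through `a`, which the structure on `TM` permutes, the derivative vanishes. -/
lemma mvfderiv_fiberDerivative_sumStructure
    (hD : IsMinimalConnection J D) {n : ℕ} {φ : M → Fin n → ℂ} {U : Set M} (hU : IsOpen U)
    (hφ : ContMDiffOn 𝓘(ℝ, E) 𝓘(ℝ, Fin n → ℂ) ∞ φ U)
    (hd : ∀ x ∈ U, Function.Bijective (mvfderiv 𝓘(ℝ, E) φ x))
    (hJ : ∀ x ∈ U, ∀ v : TangentSpace 𝓘(ℝ, E) x,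
      mvfderiv 𝓘(ℝ, E) φ x (J.toFun x v) = Complex.I • mvfderiv 𝓘(ℝ, E) φ x v)
    {a : TangentBundle 𝓘(ℝ, E) M} (ha : a.proj ∈ U) (w : TangentSpace 𝓘(ℝ, E).tangent a) :
    mvfderiv 𝓘(ℝ, E).tangent (fiberDerivative φ) a (sumStructure D J a w) =
      Complex.I • mvfderiv 𝓘(ℝ, E).tangent (fiberDerivative φ) a w := by
  obtain ⟨x, y⟩ := a
  have hx : x ∈ U := ha
  obtain ⟨c, rfl⟩ : ∃ c, coordinateField (E := E) φ c x = y :=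
    ⟨_, (hd x hx).1 (mvfderiv_coordinateField (hd x hx) (mvfderiv 𝓘(ℝ, E) φ x y))⟩
  have hY := mdifferentiableAt_coordinateField hU hφ hx (hd x hx) c
  have hval : ∀ z ∈ U, mvfderiv 𝓘(ℝ, E) φ z (coordinateField φ c z) = c :=
    fun z hz => mvfderiv_coordinateField (hd z hz) c
  have hDJ := hD.coordinateField_apply hU hφ hd hJ hx c
  generalize coordinateField (E := E) φ c = Y at *
  have hconst : ∀ u : TangentSpace 𝓘(ℝ, E) x,
      mvfderiv 𝓘(ℝ, E).tangent (fiberDerivative φ) (⟨x, Y x⟩ : TangentBundle 𝓘(ℝ, E) M)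
        (mfderiv 𝓘(ℝ, E) 𝓘(ℝ, E).tangent
          (fun y => (⟨y, Y y⟩ : TangentBundle 𝓘(ℝ, E) M)) x u) = 0 := by
    intro u
    rw [mvfderiv_fiberDerivative_section hU hφ hx hY]
    have h1 : (fun z => mvfderiv 𝓘(ℝ, E) φ z (Y z)) =ᶠ[𝓝 x] fun _ => c := by
      filter_upwards [hU.mem_nhds hx] with z hz using hval z hz
    rw [mvfderiv_congr h1]
    exact DFunLike.congr_fun (mfderiv_const (I := 𝓘(ℝ, E)) (I' := 𝓘(ℝ, Fin n → ℂ))) u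
  obtain ⟨v, hv⟩ := exists_eq_add_verticalLift (dproj_mfderiv_section hY (dproj _ w)).symm
  have hJv : sumStructure D J (⟨x, Y x⟩ : TangentBundle 𝓘(ℝ, E) M) w =
      mfderiv 𝓘(ℝ, E) 𝓘(ℝ, E).tangent
        (fun y => (⟨y, Y y⟩ : TangentBundle 𝓘(ℝ, E) M)) x (J.toFun x (dproj _ w)) +
      verticalLift _ (J.toFun x v) := by
    refine eq_of_dproj_eq_of_connector_eq D ?_ ?_
    · rw [dproj_sumStructure, map_add, dproj_verticalLift, add_zero, dproj_mfderiv_section hY]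
    · rw [connector_sumStructure, map_add, connector_verticalLift, connector_mfderiv_section D hY,
        hDJ]
      conv_lhs => rw [hv]
      rw [map_add, connector_verticalLift, connector_mfderiv_section D hY, map_add]
  have h1 := mvfderiv_fiberDerivative_verticalLift hU hφ
    (a := (⟨x, Y x⟩ : TangentBundle 𝓘(ℝ, E) M)) ha
  conv_rhs => rw [hv]
  rw [hJv, map_add, map_add, hconst, hconst, zero_add, zero_add, h1, h1]
  exact hJ x hx v

variable [T2Space M]

/-- If `J` is integrable, so is the structure on `TM`: holomorphic coordinates `φ` of `M` give the
coordinates `(φ, dφ)` of `TM`. -/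
theorem integrable_sumAlmostComplexStructure (hD : IsMinimalConnection J D) (hJ : J.Integrable) :
    (sumAlmostComplexStructure J hD.smooth).Integrable := by
  refine AlmostComplexStructure.integrable_of_immersion _ fun p => ?_
  obtain ⟨n, φ, U, hU, hp, hφ, hd, hφJ⟩ := hJ.exists_coordinates p.proj
  have hUT : IsOpen (TotalSpace.proj ⁻¹' U : Set (TangentBundle 𝓘(ℝ, E) M)) :=
    hU.preimage (FiberBundle.continuous_proj E _)
  -- `ℂⁿ × ℂⁿ` as `ℂ²ⁿ`
  let B := Module.finBasis ℂ ((Fin n → ℂ) × (Fin n → ℂ))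
  let Q : ((Fin n → ℂ) × (Fin n → ℂ)) →L[ℂ] (Fin _ → ℂ) :=
    LinearMap.toContinuousLinearMap B.equivFun.toLinearMap
  let Qr : ((Fin n → ℂ) × (Fin n → ℂ)) →L[ℝ] (Fin _ → ℂ) := Q.restrictScalars ℝ
  have hQ : ∀ z, Q (Complex.I • z) = Complex.I • Q z := fun z => map_smul Q Complex.I z
  let ψ : TangentBundle 𝓘(ℝ, E) M → (Fin n → ℂ) × (Fin n → ℂ) :=
    fun a => (φ a.proj, fiberDerivative φ a)
  have hφa : ∀ {a : TangentBundle 𝓘(ℝ, E) M}, a.proj ∈ U →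
      MDifferentiableAt 𝓘(ℝ, E) 𝓘(ℝ, Fin n → ℂ) φ a.proj := fun ha =>
    (hφ.contMDiffAt (hU.mem_nhds ha)).mdifferentiableAt (by simp)
  have hderiv : ∀ a : TangentBundle 𝓘(ℝ, E) M, a.proj ∈ U →
      ∀ w : TangentSpace 𝓘(ℝ, E).tangent a,
      mvfderiv 𝓘(ℝ, E).tangent (fun b => Q (ψ b)) a w =
        Q (mvfderiv 𝓘(ℝ, E) φ a.proj (dproj a w),
          mvfderiv 𝓘(ℝ, E).tangent (fiberDerivative φ) a w) := by
    intro a ha w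
    have hq : MDifferentiableAt 𝓘(ℝ, E).tangent 𝓘(ℝ, Fin n → ℂ)
      (fun b : TangentBundle 𝓘(ℝ, E) M => φ b.proj) a := (hφa ha).comp a (mdifferentiableAt_proj a)
    have hf := mdifferentiableAt_fiberDerivative hU hφ ha
    have h1 : HasMFDerivAt 𝓘(ℝ, E).tangent 𝓘(ℝ, (Fin n → ℂ) × (Fin n → ℂ)) ψ a
        ((mvfderiv 𝓘(ℝ, E).tangent (fun b : TangentBundle 𝓘(ℝ, E) M => φ b.proj) a).prod
          (mvfderiv 𝓘(ℝ, E).tangent (fiberDerivative φ) a)) :=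
      ⟨hq.continuousAt.prodMk hf.continuousAt, hq.hasMFDerivAt.2.prodMk hf.hasMFDerivAt.2⟩
    have h2 := (Qr.hasMFDerivAt (x := ψ a)).comp a h1
    rw [← mvfderiv_comp_proj a (hφa ha)]
    exact DFunLike.congr_fun h2.mfderiv w
  refine ⟨_, fun b => Q (ψ b), TotalSpace.proj ⁻¹' U, hUT, hp, ?_, ?_, ?_⟩
  · refine Qr.contMDiff.comp_contMDiffOn (ContMDiffOn.prodMk_space ?_ (contMDiffOn_mvfderiv hU hφ))
    exact hφ.comp (contMDiff_proj _).contMDiffOn fun _ h => h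
  · rw [injective_iff_map_eq_zero]
    intro w hw
    rw [hderiv p hp] at hw
    have hw' := B.equivFun.injective (hw.trans (map_zero Q).symm)
    have h1 : dproj p w = 0 := (hd _ hp).1 ((congrArg Prod.fst hw').trans (map_zero _).symm)
    obtain ⟨v, hv⟩ := exists_eq_add_verticalLift (w := w) (w' := 0) (h1.trans (map_zero _).symm)
    rw [zero_add] at hv
    have h2 : mvfderiv 𝓘(ℝ, E).tangent (fiberDerivative φ) p w = 0 := congrArg Prod.snd hw'
    rw [hv, mvfderiv_fiberDerivative_verticalLift hU hφ hp] at h2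
    rw [hv, (hd _ hp).1 (h2.trans (map_zero _).symm), map_zero]
  · intro a ha w
    change mvfderiv 𝓘(ℝ, E).tangent (fun b => Q (ψ b)) a (sumStructure D J a w) = _
    rw [hderiv a ha, hderiv a ha, dproj_sumStructure, hφJ _ ha]
    suffices h : mvfderiv 𝓘(ℝ, E).tangent (fiberDerivative φ) a (sumStructure D J a w) =
        Complex.I • mvfderiv 𝓘(ℝ, E).tangent (fiberDerivative φ) a w by
      rw [h, ← hQ]
      rfl
    exact mvfderiv_fiberDerivative_sumStructure J hD hU hφ hd hφJ ha w

/-- If the structure on `TM` is integrable, so is `J`, since the zero section is a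
pseudoholomorphic immersion. -/
theorem integrable_of_integrable_sumAlmostComplexStructure (hD : D.ContMDiffCovariantDerivative ∞)
    (h : (sumAlmostComplexStructure J hD).Integrable) : J.Integrable := by
  refine AlmostComplexStructure.integrable_of_immersion _ fun p => ?_
  obtain ⟨n, φ, U, hU, hp, hφ, hd, hφJ⟩ := h.exists_coordinates (zeroSec p)
  have hz : Continuous (zeroSec : M → TangentBundle 𝓘(ℝ, E) M) := contMDiff_zeroSec.continuous
  have hderiv : ∀ x ∈ (zeroSec ⁻¹' U : Set M), ∀ v : TangentSpace 𝓘(ℝ, E) x,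
      mvfderiv 𝓘(ℝ, E) (fun y => φ (zeroSec y)) x v =
        mvfderiv 𝓘(ℝ, E).tangent φ (zeroSec x) (mfderiv 𝓘(ℝ, E) 𝓘(ℝ, E).tangent zeroSec x v) :=
    fun x hx v => (mvfderiv_comp_mfderiv x
      ((hφ.contMDiffAt (hU.mem_nhds hx)).mdifferentiableAt (by simp))
      (contMDiff_zeroSec.mdifferentiable (by simp) x) v).symm
  refine ⟨n, fun y => φ (zeroSec y), zeroSec ⁻¹' U, hU.preimage hz, hp,
    hφ.comp contMDiff_zeroSec.contMDiffOn fun _ h => h, fun v v' hv => ?_, fun x hx v => ?_⟩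
  · rw [hderiv p hp, hderiv p hp] at hv
    have h1 := congrArg (dproj (zeroSec p)) ((hd _ hp).1 hv)
    rwa [dproj_mfderiv_zeroSec, dproj_mfderiv_zeroSec] at h1
  · rw [hderiv x hx, hderiv x hx, (pseudoholomorphic_zeroSec J hD).2 x v, hφJ _ hx]

end Integrability

end AlmostComplex

end

theorem mainTheorem1 {E : Type*} [NormedAddCommGroup E] [NormedSpace ℝ E] [FiniteDimensional ℝ E]
    {M : Type*} [TopologicalSpace M] [T2Space M] [SigmaCompactSpace M]
    [ChartedSpace E M] [IsManifold 𝓘(ℝ, E) ∞ M]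
    (J : AlmostComplex.AlmostComplexStructure 𝓘(ℝ, E) M) :
    (∃ D : CovariantDerivative 𝓘(ℝ, E) E (TangentSpace 𝓘(ℝ, E) : M → Type _),
      AlmostComplex.IsMinimalConnection J D) ∧
    (∀ D : CovariantDerivative 𝓘(ℝ, E) E (TangentSpace 𝓘(ℝ, E) : M → Type _),
      AlmostComplex.IsMinimalConnection J D →
      ∀ a : TangentBundle 𝓘(ℝ, E) M,
        IsCompl (AlmostComplex.horizontalSpace D a) (AlmostComplex.verticalSpace a) ∧
        BijOn (AlmostComplex.dproj a) (AlmostComplex.horizontalSpace D a) univ ∧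
        BijOn (AlmostComplex.verticalLift a) univ (AlmostComplex.verticalSpace a)) ∧
    ∃ Jhat : AlmostComplex.AlmostComplexStructure 𝓘(ℝ, E).tangent (TangentBundle 𝓘(ℝ, E) M),
      (∀ D : CovariantDerivative 𝓘(ℝ, E) E (TangentSpace 𝓘(ℝ, E) : M → Type _),
        AlmostComplex.IsMinimalConnection J D →
        ∀ K : (∀ a : TangentBundle 𝓘(ℝ, E) M,
            TangentSpace 𝓘(ℝ, E).tangent a →L[ℝ] TangentSpace 𝓘(ℝ, E).tangent a),
          AlmostComplex.IsSumStructure J D K ↔ K = Jhat.toFun) ∧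
      AlmostComplex.Pseudoholomorphic Jhat J
        (AlmostComplex.proj : TangentBundle 𝓘(ℝ, E) M → M) ∧
      AlmostComplex.Pseudoholomorphic J Jhat
        (AlmostComplex.zeroSec : M → TangentBundle 𝓘(ℝ, E) M) ∧
      (Jhat.Integrable ↔ J.Integrable) := by
  obtain ⟨D, hD⟩ := AlmostComplex.exists_isMinimalConnection J
  refine ⟨⟨D, hD⟩, fun D' _ a => ⟨AlmostComplex.isCompl_horizontalSpace_verticalSpace D' a,
    AlmostComplex.bijOn_dproj D' a, AlmostComplex.bijOn_verticalLift a⟩,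
    AlmostComplex.sumAlmostComplexStructure J hD.smooth, fun D' hD' K => ?_,
    AlmostComplex.pseudoholomorphic_proj J hD.smooth,
    AlmostComplex.pseudoholomorphic_zeroSec J hD.smooth,
    AlmostComplex.integrable_of_integrable_sumAlmostComplexStructure J hD.smooth,
    AlmostComplex.integrable_sumAlmostComplexStructure J hD⟩
  rw [AlmostComplex.isSumStructure_iff, AlmostComplex.sumStructure_eq J hD' hD]
  rfl
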